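/- There is an absolute constant $C>0$ such that for every integer $n\ge 3$, every rooted tree $T$ with $n$ vertices (of arbitrary degrees) has a planar straight-line upward drawing on an integer grid $\{1,\ldots,W\}\times\{1,\ldots,H\}$ whose area $W\cdot H$ satisfies $$W\cdot H\ \le\ C\, n\,\sqrt{\log n}\,(\log\log n)^2 .$$ Here the vertices of $T$ are mapped to distinct points of the grid and each edge is drawn as the straight line segment between the images of its endpoints; the drawing is planar if no edge passes through a vertex other than its endpoints and two distinct edges meet at most in the image of a common endpoint; and it is upward if the $y$-coordinate of each vertex is greater than or equal to the $y$-coordinate of each of its children. The logarithm is natural. -/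

import Mathlib

universe u

/-- The point of the real plane with the given integer coordinates. -/
def gridPoint (p : ℤ × ℤ) : ℝ × ℝ := ((p.1 : ℝ), (p.2 : ℝ))

/-- A planar straight-line drawing of the graph `G` on the integer grid
`{1, …, W} × {1, …, H}`: vertices are mapped to distinct grid points and every edge is drawn as
the closed line segment joining the images of its endpoints. Planarity means that an edge passes
through no vertex other than its endpoints, and that two distinct edges have no point in common
except the image of a shared endpoint. -/
structure StraightLineGridDrawing {V : Type u} (G : SimpleGraph V) (W H : ℕ) where
  /-- the grid point at which a vertex is drawn -/
  pos : V → ℤ × ℤ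
  pos_fst_mem : ∀ v, (pos v).1 ∈ Set.Icc (1 : ℤ) (W : ℤ)
  pos_snd_mem : ∀ v, (pos v).2 ∈ Set.Icc (1 : ℤ) (H : ℤ)
  pos_injective : Function.Injective pos
  edge_avoids_vertices : ∀ u v w : V, G.Adj u v →
    gridPoint (pos w) ∈ segment ℝ (gridPoint (pos u)) (gridPoint (pos v)) → w = u ∨ w = v
  edges_noncrossing : ∀ u v x y : V, G.Adj u v → G.Adj x y → s(u, v) ≠ s(x, y) →
    ∀ p : ℝ × ℝ, p ∈ segment ℝ (gridPoint (pos u)) (gridPoint (pos v)) →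
      p ∈ segment ℝ (gridPoint (pos x)) (gridPoint (pos y)) →
      ∃ w : V, (w = u ∨ w = v) ∧ (w = x ∨ w = y) ∧ p = gridPoint (pos w)

/-- In the tree `G` rooted at `r`, the vertex `w` is a child of the vertex `v`: they are adjacent
and `w` is one step further from the root. -/
def IsChildOf {V : Type u} (G : SimpleGraph V) (r v w : V) : Prop :=
  G.Adj v w ∧ G.dist r w = G.dist r v + 1

/-- A drawing of a tree rooted at `r` is upward if the `y`-coordinate of each vertex is greater
than or equal to the `y`-coordinate of each of its children. -/
def StraightLineGridDrawing.IsUpward {V : Type u} {G : SimpleGraph V} {W H : ℕ}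
    (D : StraightLineGridDrawing G W H) (r : V) : Prop :=
  ∀ v w : V, IsChildOf G r v w → (D.pos w).2 ≤ (D.pos v).2

open Finset

/-! Let Q be about the square root of log n. It suffices to draw the tree with O(Q²) columns and O(n
log Q / Q) rows, since the area is then O(n Q log Q). Rows are counted downwards until the very end.

The basic drawing has n columns and log₂ n + 1 rows (`canDraw_log`): the heaviest child continues in
the row of its parent, the others hang on a shelf below. Both coordinates increase along its edges,
so a vertical shear of nonnegative slope leaves it upward.

High degrees are handled by fans (`exists_fan`, `exists_star`). Children with subtrees of size a ≤ Q
receive sheared a × a squares. Dirichlet's theorem replaces the current slope by some p/q with q ≤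
Q; the corners of the squares are put on a lattice line of slope p/q and the squares on its far
side, so the parent sees every corner. The slope gained in a full sector is charged to the sizes in
it, so a fan of total size s needs O(Q²) columns and O(s/Q + Q) rows. Larger subtrees are stacked
below the fan, one column in, except one heaviest subtree, which goes to the bottom at full width
(`CanDraw.star`). A column is thus lost only when the size halves, at most log₂ n = O(Q²) times.

A star costs O(Q) rows even if little hangs on it. Therefore vertices with a dominating child
(`Thin`) are strung along a row, with shelves of height O(log Q), until the O(Q²) columns are used
up; the last one stands in the right corner, with the rest of the tree mirrored below it. The
induction `exists_drawing` bounds Q · H by 200 l · size minus a reserve: 200 Q² in general, 300 Q²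
at vertices that are not thin. These reserves, together with the filled columns, pay for the stars
and for the ends of rows. -/

/-- A rooted tree on `V`, given by its parent function; the root is its own parent. -/
structure ParentTree (V : Type u) where
  root : V
  par : V → V
  depth : V → ℕ
  par_root : par root = root
  depth_par : ∀ x, x ≠ root → depth x = depth (par x) + 1

/-! ### Subtrees and their sizes -/

namespace ParentTree

variable {V : Type u} [Fintype V] (T : ParentTree V)

open Classical in
/-- The children of a vertex. -/
noncomputable def ch (v : V) : Finset V := univ.filter fun x => x ≠ T.root ∧ T.par x = v

open Classical in
/-- The vertex set of the subtree rooted at `v`. -/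
noncomputable def sub (v : V) : Finset V := univ.filter fun x => ∃ k : ℕ, T.par^[k] x = v

/-- The number of vertices of the subtree rooted at `v`. -/
noncomputable def sz (v : V) : ℕ := (T.sub v).card

variable {T}

theorem mem_ch {v x : V} : x ∈ T.ch v ↔ x ≠ T.root ∧ T.par x = v := by simp [ch]

theorem mem_sub {v x : V} : x ∈ T.sub v ↔ ∃ k : ℕ, T.par^[k] x = v := by simp [sub]

theorem self_mem_sub (v : V) : v ∈ T.sub v := mem_sub.2 ⟨0, rfl⟩

theorem mem_sub_of_par {v x : V} (h : T.par x ∈ T.sub v) : x ∈ T.sub v := by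
  obtain ⟨k, hk⟩ := mem_sub.1 h
  exact mem_sub.2 ⟨k + 1, hk⟩

theorem ne_root_of_mem_sub {v x : V} (h : x ∈ T.sub v) (hx : x ≠ v) : x ≠ T.root := by
  rintro rfl
  obtain ⟨k, hk⟩ := mem_sub.1 h
  rw [Function.iterate_fixed T.par_root] at hk
  exact hx hk

theorem par_mem_sub {v x : V} (h : x ∈ T.sub v) (hx : x ≠ v) : T.par x ∈ T.sub v := by
  obtain ⟨k, hk⟩ := mem_sub.1 h
  cases k with
  | zero => exact absurd hk hx
  | succ k => exact mem_sub.2 ⟨k, hk⟩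

theorem depth_le_of_mem_sub {v x : V} (h : x ∈ T.sub v) : T.depth v ≤ T.depth x := by
  induction hn : T.depth x using Nat.strong_induction_on generalizing x with
  | _ n ih =>
    by_cases hx : x = v
    · subst hx; exact hn.le
    · have h1 := T.depth_par x (ne_root_of_mem_sub h hx)
      have := ih (T.depth (T.par x)) (by omega) (par_mem_sub h hx) rfl
      omega

/-- Going from `x` to its parents lowers the depth by one at each step, so an ancestor is determined
by its depth. This gives disjointness of the subtrees of siblings. -/
theorem eq_of_mem_sub_of_depth_eq {a b x : V} (ha : x ∈ T.sub a) (hb : x ∈ T.sub b)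
    (hd : T.depth a = T.depth b) : a = b := by
  induction hn : T.depth x using Nat.strong_induction_on generalizing x with
  | _ n ih =>
    have key : ∀ {c : V}, x ∈ T.sub c → x ≠ c → T.depth c < T.depth x := fun {c} hc hx => by
      have h1 := T.depth_par x (ne_root_of_mem_sub hc hx)
      have := depth_le_of_mem_sub (par_mem_sub hc hx)
      omega
    by_cases hxa : x = a
    · by_cases hxb : x = b
      · exact hxa.symm.trans hxb
      · have := key hb hxb
        subst hxa; omega
    · by_cases hxb : x = b
      · have := key ha hxa
        subst hxb; omega
      · have h1 := T.depth_par x (ne_root_of_mem_sub ha hxa)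
        exact ih (T.depth (T.par x)) (by omega) (par_mem_sub ha hxa) (par_mem_sub hb hxb) rfl

theorem mem_sub_iff {v x : V} : x ∈ T.sub v ↔ x = v ∨ ∃ c ∈ T.ch v, x ∈ T.sub c := by
  constructor
  · intro h
    obtain ⟨k, hk⟩ := mem_sub.1 h
    induction k generalizing x with
    | zero => exact Or.inl hk
    | succ k ih =>
      by_cases hx : x = v
      · exact Or.inl hx
      · right
        rcases ih (mem_sub.2 ⟨k, hk⟩) hk with h1 | ⟨c, hc, h1⟩
        · exact ⟨x, mem_ch.2 ⟨ne_root_of_mem_sub h hx, h1⟩, self_mem_sub x⟩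
        · exact ⟨c, hc, mem_sub_of_par h1⟩
  · rintro (rfl | ⟨c, hc, h⟩)
    · exact self_mem_sub x
    · obtain ⟨k, hk⟩ := mem_sub.1 h
      refine mem_sub.2 ⟨k + 1, ?_⟩
      rw [Function.iterate_succ_apply', hk]
      exact (mem_ch.1 hc).2

theorem depth_of_mem_ch {v c : V} (h : c ∈ T.ch v) : T.depth c = T.depth v + 1 := by
  rw [mem_ch] at h
  rw [T.depth_par c h.1, h.2]

theorem notMem_sub_of_mem_ch {v c : V} (h : c ∈ T.ch v) : v ∉ T.sub c := fun hv => by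
  have := depth_le_of_mem_sub hv
  have := depth_of_mem_ch h
  omega

theorem ne_of_mem_ch {v c : V} (h : c ∈ T.ch v) : c ≠ v := by
  rintro rfl
  exact notMem_sub_of_mem_ch h (self_mem_sub c)

theorem eq_of_mem_sub_ch {v c c' x : V} (h : c ∈ T.ch v) (h' : c' ∈ T.ch v)
    (hx : x ∈ T.sub c) (hx' : x ∈ T.sub c') : c = c' :=
  eq_of_mem_sub_of_depth_eq hx hx' (by rw [depth_of_mem_ch h, depth_of_mem_ch h'])

theorem mem_sub_root (x : V) : x ∈ T.sub T.root := by
  induction hn : T.depth x using Nat.strong_induction_on generalizing x with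
  | _ n ih =>
    by_cases hx : x = T.root
    · rw [hx]; exact self_mem_sub _
    · have h1 := T.depth_par x hx
      exact mem_sub_of_par (ih (T.depth (T.par x)) (by omega) _ rfl)

theorem sub_root : T.sub T.root = univ := eq_univ_iff_forall.2 mem_sub_root

theorem sz_eq (v : V) : T.sz v = 1 + ∑ c ∈ T.ch v, T.sz c := by
  classical
  have h : T.sub v = insert v ((T.ch v).biUnion T.sub) := by
    ext x
    rw [mem_sub_iff, mem_insert, mem_biUnion]
  rw [sz, h, card_insert_of_notMem, card_biUnion, add_comm]
  · rfl
  · intro c hc c' hc' hne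
    refine Finset.disjoint_left.2 fun x hx hx' => ?_
    exact hne (eq_of_mem_sub_ch hc hc' hx hx')
  · rw [mem_biUnion]
    rintro ⟨c, hc, h⟩
    exact notMem_sub_of_mem_ch hc h

theorem sz_pos (v : V) : 1 ≤ T.sz v := by rw [sz_eq]; omega

theorem sz_ch_lt {v c : V} (h : c ∈ T.ch v) : T.sz c < T.sz v := by
  have := single_le_sum (f := T.sz) (fun _ _ => Nat.zero_le _) h
  rw [sz_eq v]; omega

open Classical in
theorem sz_eq_add_erase {v u : V} (h : u ∈ T.ch v) :
    T.sz v = 1 + T.sz u + ∑ c ∈ (T.ch v).erase u, T.sz c := by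
  rw [sz_eq v, ← add_sum_erase _ _ h]; omega

end ParentTree

/-! ### Segments between grid points -/

/-- The straight segment between two grid points. -/
def gridSeg (a b : ℤ × ℤ) : Set (ℝ × ℝ) := segment ℝ (gridPoint a) (gridPoint b)

theorem mem_gridSeg {a b : ℤ × ℤ} {p : ℝ × ℝ} : p ∈ gridSeg a b ↔
    ∃ t : ℝ, 0 ≤ t ∧ t ≤ 1 ∧ p.1 = a.1 + t * (b.1 - a.1) ∧ p.2 = a.2 + t * (b.2 - a.2) := by
  rw [gridSeg, segment_eq_image', Set.mem_image]
  constructor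
  · rintro ⟨t, ⟨h0, h1⟩, rfl⟩
    exact ⟨t, h0, h1, by simp [gridPoint], by simp [gridPoint]⟩
  · rintro ⟨t, h0, h1, h2, h3⟩
    refine ⟨t, ⟨h0, h1⟩, ?_⟩
    ext
    · simp [gridPoint, h2]
    · simp [gridPoint, h3]

theorem left_mem_gridSeg (a b : ℤ × ℤ) : gridPoint a ∈ gridSeg a b := left_mem_segment ..

theorem right_mem_gridSeg (a b : ℤ × ℤ) : gridPoint b ∈ gridSeg a b := right_mem_segment ..

theorem gridPoint_injective : Function.Injective gridPoint := by
  rintro ⟨a, b⟩ ⟨c, d⟩ h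
  simpa [gridPoint] using h

/-! ### Drawings of subtrees: merging and affine images -/

namespace ParentTree

variable {V : Type u} [Fintype V]

/-- `T.Draws ρ v pos R`: the map `pos` is a planar straight-line drawing inside the region `R` of
the subtree of `T` rooted at `v`, in which every parent-child pair satisfies `ρ`. -/
structure Draws (T : ParentTree V) (ρ : ℤ × ℤ → ℤ × ℤ → Prop) (v : V) (pos : V → ℤ × ℤ)
    (R : Set (ℝ × ℝ)) : Prop where
  inj : Set.InjOn pos (T.sub v)
  pt_mem : ∀ x ∈ T.sub v, gridPoint (pos x) ∈ R
  seg_sub : ∀ x ∈ T.sub v, x ≠ v → gridSeg (pos (T.par x)) (pos x) ⊆ R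
  cross : ∀ x ∈ T.sub v, ∀ y ∈ T.sub v, x ≠ v → y ≠ v → x ≠ y →
    ∀ p ∈ gridSeg (pos (T.par x)) (pos x), p ∈ gridSeg (pos (T.par y)) (pos y) →
      ∃ w, (w = x ∨ w = T.par x) ∧ (w = y ∨ w = T.par y) ∧ p = gridPoint (pos w)
  rel : ∀ x ∈ T.sub v, x ≠ v → ρ (pos (T.par x)) (pos x)

/-- The subtree rooted at `v` can be drawn inside `R` with `v` at the grid point `O`. -/
def CanDraw (T : ParentTree V) (ρ : ℤ × ℤ → ℤ × ℤ → Prop) (v : V) (O : ℤ × ℤ)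
    (R : Set (ℝ × ℝ)) : Prop := ∃ pos : V → ℤ × ℤ, pos v = O ∧ T.Draws ρ v pos R

variable {T : ParentTree V} {ρ ρ' : ℤ × ℤ → ℤ × ℤ → Prop} {v : V}

theorem CanDraw.mono {O : ℤ × ℤ} {R R' : Set (ℝ × ℝ)} (h : T.CanDraw ρ v O R) (hR : R ⊆ R') :
    T.CanDraw ρ v O R' := by
  obtain ⟨pos, h0, h⟩ := h
  exact ⟨pos, h0, h.inj, fun x hx => hR (h.pt_mem x hx), fun x hx hv => (h.seg_sub x hx hv).trans hR,
    h.cross, h.rel⟩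

/-- In a drawing, an edge passes through no vertex other than its ends. -/
theorem Draws.avoid {pos : V → ℤ × ℤ} {R : Set (ℝ × ℝ)} (h : T.Draws ρ v pos R) {x y : V}
    (hx : x ∈ T.sub v) (hy : y ∈ T.sub v) (hyv : y ≠ v)
    (hp : gridPoint (pos x) ∈ gridSeg (pos (T.par y)) (pos y)) : x = y ∨ x = T.par y := by
  -- If `x` is an end of some edge, `cross` applied to that edge and the edge of `y` identifies `x`
  -- as a common end. Such an edge always exists: the parent edge of `x`, or, for `x = v`, the edge
  -- to the child above `y`.
  have key : ∀ z ∈ T.sub v, z ≠ v → (x = z ∨ x = T.par z) → x = y ∨ x = T.par y := by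
    intro z hz hzv hxz
    by_cases hzy : z = y
    · rwa [hzy] at hxz
    have hpz : gridPoint (pos x) ∈ gridSeg (pos (T.par z)) (pos z) := by
      rcases hxz with e | e <;> rw [e]
      · exact right_mem_gridSeg ..
      · exact left_mem_gridSeg ..
    obtain ⟨w, hw, hw', e⟩ := h.cross z hz y hy hzv hyv hzy _ hpz hp
    have hwv : w ∈ T.sub v := by
      rcases hw with rfl | rfl
      · exact hz
      · exact par_mem_sub hz hzv
    rwa [h.inj hx hwv (gridPoint_injective e)]
  by_cases hxv : x = v
  · obtain e | ⟨c, hc, hyc⟩ := mem_sub_iff.1 hy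
    · exact absurd e hyv
    · exact key c (mem_sub_iff.2 (Or.inr ⟨c, hc, self_mem_sub c⟩)) (ne_of_mem_ch hc)
        (Or.inr (hxv.trans (mem_ch.1 hc).2.symm))
  · exact key x hx hxv (Or.inl rfl)

/-- Two pairs (end of the edge from `O`, region) do not interfere. -/
structure Apart (O P P' : ℤ × ℤ) (R R' : Set (ℝ × ℝ)) : Prop where
  reg : ∀ p ∈ R, p ∉ R'
  segl : ∀ p ∈ gridSeg O P, p ∉ R'
  segr : ∀ p ∈ gridSeg O P', p ∉ R
  segs : ∀ p ∈ gridSeg O P, p ∈ gridSeg O P' → p = gridPoint O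

theorem Apart.symm {O P P' : ℤ × ℤ} {R R' : Set (ℝ × ℝ)} (h : Apart O P P' R R') :
    Apart O P' P R' R :=
  ⟨fun p hp hp' => h.reg p hp' hp, h.segr, h.segl, fun p hp hp' => h.segs p hp' hp⟩

open Classical in
/-- Drawings of the subtrees of the children of `v` in non-interfering regions combine to a drawing
of the subtree of `v`. -/
theorem CanDraw.merge {O : ℤ × ℤ} {P : V → ℤ × ℤ} {Rc : V → Set (ℝ × ℝ)} {R : Set (ℝ × ℝ)}
    (hc : ∀ c ∈ T.ch v, T.CanDraw ρ c (P c) (Rc c))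
    (hO : ∀ c ∈ T.ch v, gridPoint O ∉ Rc c)
    (hend : ∀ c ∈ T.ch v, ∀ p ∈ gridSeg O (P c), p ∈ Rc c → p = gridPoint (P c))
    (hap : ∀ c ∈ T.ch v, ∀ c' ∈ T.ch v, c ≠ c' → Apart O (P c) (P c') (Rc c) (Rc c'))
    (hρ : ∀ c ∈ T.ch v, ρ O (P c))
    (hOR : gridPoint O ∈ R) (hsR : ∀ c ∈ T.ch v, gridSeg O (P c) ⊆ R)
    (hcR : ∀ c ∈ T.ch v, Rc c ⊆ R) : T.CanDraw ρ v O R := by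
  choose! q hq hd using hc
  -- Within the subtree of `v` only `v` lies in no child's subtree, so the default value `O` is its
  -- position.
  let pos : V → ℤ × ℤ := fun x => if h : ∃ c ∈ T.ch v, x ∈ T.sub c then q h.choose x else O
  have posc : ∀ c ∈ T.ch v, ∀ x ∈ T.sub c, pos x = q c x := fun c hc x hx => by
    have h : ∃ c ∈ T.ch v, x ∈ T.sub c := ⟨c, hc, hx⟩
    have e : h.choose = c := eq_of_mem_sub_ch h.choose_spec.1 hc h.choose_spec.2 hx
    simp only [pos, dif_pos h, e]
  have posv : pos v = O := by
    have h : ¬ ∃ c ∈ T.ch v, v ∈ T.sub c := fun ⟨c, hc, h⟩ => notMem_sub_of_mem_ch hc h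
    simp only [pos, dif_neg h]
  have posch : ∀ c ∈ T.ch v, pos c = P c := fun c hc => by
    rw [posc c hc c (self_mem_sub c), hq c hc]
  -- every vertex other than `v` is a child of `v` or lies deeper
  have cases_of : ∀ x ∈ T.sub v, x ≠ v → ∃ c ∈ T.ch v, x ∈ T.sub c ∧
      ((x = c ∧ T.par x = v ∧ gridSeg (pos (T.par x)) (pos x) = gridSeg O (P c)) ∨
       (x ≠ c ∧ T.par x ∈ T.sub c ∧
        gridSeg (pos (T.par x)) (pos x) = gridSeg (q c (T.par x)) (q c x))) := fun x hx hxv => by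
    obtain h | ⟨c, hc, h⟩ := mem_sub_iff.1 hx
    · exact absurd h hxv
    · refine ⟨c, hc, h, ?_⟩
      by_cases hxc : x = c
      · left
        subst hxc
        have := (mem_ch.1 hc).2
        refine ⟨rfl, this, ?_⟩
        rw [this, posv, posch x hc]
      · right
        have hp := par_mem_sub h hxc
        exact ⟨hxc, hp, by rw [posc c hc x h, posc c hc _ hp]⟩
  have pt : ∀ c ∈ T.ch v, ∀ x ∈ T.sub c, gridPoint (pos x) ∈ Rc c := fun c hc x hx => by
    rw [posc c hc x hx]; exact (hd c hc).pt_mem x hx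
  refine ⟨pos, posv, ?_, ?_, ?_, ?_, ?_⟩
  · intro x hx y hy hxy
    obtain h | ⟨c, hc, h⟩ := mem_sub_iff.1 hx
    · obtain h' | ⟨c', hc', h'⟩ := mem_sub_iff.1 hy
      · rw [h, h']
      · have := pt c' hc' y h'
        rw [← hxy, h, posv] at this
        exact absurd this (hO c' hc')
    · obtain h' | ⟨c', hc', h'⟩ := mem_sub_iff.1 hy
      · have := pt c hc x h
        rw [hxy, h', posv] at this
        exact absurd this (hO c hc)
      · by_cases hcc : c = c'
        · subst hcc
          rw [posc c hc x h, posc c hc y h'] at hxy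
          exact (hd c hc).inj h h' hxy
        · have h1 := pt c hc x h
          have h2 := pt c' hc' y h'
          rw [hxy] at h1
          exact absurd h2 ((hap c hc c' hc' hcc).reg _ h1)
  · intro x hx
    obtain h | ⟨c, hc, h⟩ := mem_sub_iff.1 hx
    · rw [h, posv]; exact hOR
    · exact hcR c hc (pt c hc x h)
  · intro x hx hxv
    obtain ⟨c, hc, h, ⟨-, -, e⟩ | ⟨hxc, -, e⟩⟩ := cases_of x hx hxv
    · rw [e]; exact hsR c hc
    · rw [e]; exact ((hd c hc).seg_sub x h hxc).trans (hcR c hc)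
  · intro x hx y hy hxv hyv hxy p hp hp'
    obtain ⟨c, hc, h, hcase⟩ := cases_of x hx hxv
    obtain ⟨c', hc', h', hcase'⟩ := cases_of y hy hyv
    by_cases hcc : c = c'
    · subst hcc
      -- an edge into the subtree meets that subtree only at its root
      have key : ∀ y ∈ T.sub c, y ≠ c → ∀ p ∈ gridSeg O (P c),
          p ∈ gridSeg (q c (T.par y)) (q c y) →
          (c = y ∨ c = T.par y) ∧ p = gridPoint (pos c) := fun y hy hyc p hp hp' => by
        have hpe := hend c hc p hp ((hd c hc).seg_sub y hy hyc hp')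
        rw [hpe, ← hq c hc] at hp'
        exact ⟨(hd c hc).avoid (self_mem_sub c) hy hyc hp', by rw [hpe, posch c hc]⟩
      rcases hcase with ⟨hxc, hpar, e⟩ | ⟨hxc, hpar, e⟩
      · rcases hcase' with ⟨hyc, hpar', e'⟩ | ⟨hyc, hpar', e'⟩
        · exact absurd (hxc.trans hyc.symm) hxy
        · rw [e] at hp
          rw [e'] at hp'
          exact ⟨c, Or.inl hxc.symm, key y h' hyc p hp hp'⟩
      · rcases hcase' with ⟨hyc, hpar', e'⟩ | ⟨hyc, hpar', e'⟩
        · rw [e] at hp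
          rw [e'] at hp'
          obtain ⟨h1, h2⟩ := key x h hxc p hp' hp
          exact ⟨c, h1, Or.inl hyc.symm, h2⟩
        · rw [e] at hp
          rw [e'] at hp'
          obtain ⟨w, hw, hw', hpw⟩ := (hd c hc).cross x h y h' hxc hyc hxy p hp hp'
          refine ⟨w, hw, hw', ?_⟩
          rw [hpw, posc c hc w]
          rcases hw with rfl | rfl
          · exact h
          · exact hpar
    · have A := hap c hc c' hc' hcc
      rcases hcase with ⟨hxc, hpar, e⟩ | ⟨hxc, hpar, e⟩
      · rw [e] at hp
        rcases hcase' with ⟨hyc, hpar', e'⟩ | ⟨hyc, hpar', e'⟩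
        · rw [e'] at hp'
          exact ⟨v, Or.inr hpar.symm, Or.inr hpar'.symm, by rw [posv]; exact A.segs p hp hp'⟩
        · rw [e'] at hp'
          exact absurd ((hd c' hc').seg_sub y h' hyc hp') (A.segl p hp)
      · rw [e] at hp
        have hpR := (hd c hc).seg_sub x h hxc hp
        rcases hcase' with ⟨hyc, hpar', e'⟩ | ⟨hyc, hpar', e'⟩
        · rw [e'] at hp'
          exact absurd hpR (A.segr p hp')
        · rw [e'] at hp'
          exact absurd ((hd c' hc').seg_sub y h' hyc hp') (A.reg p hpR)
  · intro x hx hxv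
    obtain ⟨c, hc, h, ⟨hxc, hpar, -⟩ | ⟨hxc, hpar, -⟩⟩ := cases_of x hx hxv
    · rw [hpar, posv, hxc, posch c hc]
      exact hρ c hc
    · rw [posc c hc x h, posc c hc _ hpar]
      exact (hd c hc).rel x h hxc

/-- Drawings are carried along the maps `(x, y) ↦ (a + s x, b + y + k x)` with `s = ±1`. -/
theorem CanDraw.map {O : ℤ × ℤ} {R R' : Set (ℝ × ℝ)} (h : T.CanDraw ρ v O R) (a b s k : ℤ)
    (hs : s = 1 ∨ s = -1)
    (hρ : ∀ p q, ρ p q → ρ' (a + s * p.1, b + p.2 + k * p.1) (a + s * q.1, b + q.2 + k * q.1))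
    (hR : ∀ p ∈ R, ((a + s * p.1, b + p.2 + k * p.1) : ℝ × ℝ) ∈ R') :
    T.CanDraw ρ' v (a + s * O.1, b + O.2 + k * O.1) R' := by
  obtain ⟨pos, rfl, h⟩ := h
  let f : ℤ × ℤ → ℤ × ℤ := fun p => (a + s * p.1, b + p.2 + k * p.1)
  let F : ℝ × ℝ → ℝ × ℝ := fun p => (a + s * p.1, b + p.2 + k * p.1)
  have hs2 : (s : ℝ) * s = 1 := by rcases hs with rfl | rfl <;> norm_num
  have fF : ∀ p, gridPoint (f p) = F (gridPoint p) := fun p => by simp [f, F, gridPoint]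
  have finj : Function.Injective f := by
    rintro ⟨x, y⟩ ⟨x', y'⟩ e
    simp only [f, Prod.mk.injEq] at e
    have hx : x = x' := by rcases hs with rfl | rfl <;> linarith [e.1]
    subst hx
    exact Prod.ext rfl (by linarith [e.2])
  have seg : ∀ p q z, z ∈ gridSeg (f p) (f q) → ∃ z' ∈ gridSeg p q, z = F z' := by
    intro p q z hz
    obtain ⟨t, h0, h1, e1, e2⟩ := mem_gridSeg.1 hz
    refine ⟨(p.1 + t * (q.1 - p.1), p.2 + t * (q.2 - p.2)),
      mem_gridSeg.2 ⟨t, h0, h1, rfl, rfl⟩, ?_⟩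
    ext
    · rw [e1]; simp only [f, F]; push_cast; ring
    · rw [e2]; simp only [f, F]; push_cast; ring
  have Finj : Function.Injective F := by
    rintro ⟨x, y⟩ ⟨x', y'⟩ e
    simp only [F, Prod.mk.injEq] at e
    have hx : x = x' := by
      have : (s : ℝ) * (s * x) = s * (s * x') := by rw [show (s : ℝ) * x = s * x' by linarith [e.1]]
      rwa [← mul_assoc, ← mul_assoc, hs2, one_mul, one_mul] at this
    subst hx
    exact Prod.ext rfl (by linarith [e.2])
  refine ⟨f ∘ pos, rfl, ?_, ?_, ?_, ?_, ?_⟩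
  · exact fun x hx y hy e => h.inj hx hy (finj e)
  · intro x hx
    rw [Function.comp_apply, fF]
    exact hR _ (h.pt_mem x hx)
  · intro x hx hxv z hz
    obtain ⟨z', hz', rfl⟩ := seg _ _ _ hz
    exact hR _ (h.seg_sub x hx hxv hz')
  · intro x hx y hy hxv hyv hxy p hp hp'
    obtain ⟨z, hz, rfl⟩ := seg _ _ _ hp
    obtain ⟨z', hz', e⟩ := seg _ _ _ hp'
    rw [← Finj e] at hz'
    obtain ⟨w, hw, hw', e'⟩ := h.cross x hx y hy hxv hyv hxy z hz hz'
    exact ⟨w, hw, hw', by rw [e', Function.comp_apply, fF]⟩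
  · exact fun x hx hxv => hρ _ _ (h.rel x hx hxv)

end ParentTree

/-! ### Shelves and the drawing of logarithmic height -/

/-- The rectangle whose lower corner is the grid point `(x, y)` and which has `w` columns and `h` rows
of grid points. -/
def box (x y w h : ℤ) : Set (ℝ × ℝ) :=
  {p | (x : ℝ) ≤ p.1 ∧ p.1 ≤ x + w - 1 ∧ (y : ℝ) ≤ p.2 ∧ p.2 ≤ y + h - 1}

theorem box_subset {x y w h x' y' w' h' : ℤ} (h1 : x' ≤ x) (h2 : x + w ≤ x' + w') (h3 : y' ≤ y)
    (h4 : y + h ≤ y' + h') : box x y w h ⊆ box x' y' w' h' := by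
  rintro p ⟨a, b, c, d⟩
  have h1 : (x' : ℝ) ≤ x := by exact_mod_cast h1
  have h2 : (x + w : ℝ) ≤ x' + w' := by exact_mod_cast h2
  have h3 : (y' : ℝ) ≤ y := by exact_mod_cast h3
  have h4 : (y + h : ℝ) ≤ y' + h' := by exact_mod_cast h4
  exact ⟨by linarith, by linarith, by linarith, by linarith⟩

/-- Intervals of prescribed lengths can be packed consecutively. -/
theorem exists_offsets {ι : Type*} (s : Finset ι) (a : ι → ℕ) : ∃ o : ι → ℕ,
    (∀ c ∈ s, o c + a c ≤ ∑ c ∈ s, a c) ∧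
    ∀ c ∈ s, ∀ c' ∈ s, c ≠ c' → o c + a c ≤ o c' ∨ o c' + a c' ≤ o c := by
  classical
  induction s using Finset.induction_on with
  | empty => exact ⟨fun _ => 0, by simp, by simp⟩
  | insert i s hi ih =>
    obtain ⟨o, h1, h2⟩ := ih
    have hne : ∀ c ∈ s, c ≠ i := fun c hc e => hi (e ▸ hc)
    refine ⟨Function.update o i (∑ c ∈ s, a c), ?_, ?_⟩
    · intro c hc
      rw [sum_insert hi]
      rcases mem_insert.1 hc with rfl | hc
      · simp [add_comm]
      · rw [Function.update_of_ne (hne c hc)]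
        have := h1 c hc
        omega
    · intro c hc c' hc' hcc
      rcases mem_insert.1 hc with hci | hcs
      · rcases mem_insert.1 hc' with hci' | hcs'
        · exact absurd (hci.trans hci'.symm) hcc
        · rw [hci, Function.update_self, Function.update_of_ne (hne c' hcs')]
          exact Or.inr (h1 c' hcs')
      · rcases mem_insert.1 hc' with hci' | hcs'
        · rw [hci', Function.update_self, Function.update_of_ne (hne c hcs)]
          exact Or.inl (h1 c hcs)
        · rw [Function.update_of_ne (hne c hcs), Function.update_of_ne (hne c' hcs')]
          exact h2 c hcs c' hcs' hcc

namespace ParentTree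

/-- The parent is in row 0 and all boxes start in row 1, so an edge can reach a box only at `t = 1`,
where the columns differ. Two edges at equal height have equal parameter, hence meet only at `t =
0`. -/
theorem apart_of_mem_row {x0 o o' : ℤ} {a a' h : ℤ} (ha : 1 ≤ a) (ha' : 1 ≤ a')
    (hoo : o + a ≤ o' ∨ o' + a' ≤ o) :
    Apart (x0, 0) (o, 1) (o', 1) (box o 1 a h) (box o' 1 a' h) := by
  have ha : (1 : ℝ) ≤ a := by exact_mod_cast ha
  have ha' : (1 : ℝ) ≤ a' := by exact_mod_cast ha'
  have hoo : (o + a : ℝ) ≤ o' ∨ (o' + a' : ℝ) ≤ o := by exact_mod_cast hoo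
  refine ⟨?_, ?_, ?_, ?_⟩
  · rintro p ⟨h1, h2, -, -⟩ ⟨h3, h4, -, -⟩
    rcases hoo with hoo | hoo <;> linarith
  · intro p hp hp'
    obtain ⟨t, h0, h1, e1, e2⟩ := mem_gridSeg.1 hp
    obtain ⟨h3, h4, h5, -⟩ := hp'
    push_cast at *
    obtain rfl : t = 1 := by linarith
    rcases hoo with hoo | hoo <;> linarith
  · intro p hp hp'
    obtain ⟨t, h0, h1, e1, e2⟩ := mem_gridSeg.1 hp
    obtain ⟨h3, h4, h5, -⟩ := hp'
    push_cast at *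
    obtain rfl : t = 1 := by linarith
    rcases hoo with hoo | hoo <;> linarith
  · intro p hp hp'
    obtain ⟨t, h0, h1, e1, e2⟩ := mem_gridSeg.1 hp
    obtain ⟨t', h0', h1', e1', e2'⟩ := mem_gridSeg.1 hp'
    push_cast at *
    obtain rfl : t = t' := by linarith
    have : t = 0 := by
      by_contra ht
      have ht : 0 < t := lt_of_le_of_ne h0 (Ne.symm ht)
      have : t * (o - o' : ℝ) = 0 := by linarith
      rcases mul_eq_zero.1 this with h | h
      · exact ht.ne' h
      · rcases hoo with hoo | hoo <;> linarith
    subst this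
    ext
    · rw [e1]; simp [gridPoint]
    · rw [e2]; simp [gridPoint]

variable {V : Type u} [Fintype V] {T : ParentTree V} {ρ : ℤ × ℤ → ℤ × ℤ → Prop} {v : V}

open Classical in
/-- Draw `v` at `(x0, 0)`, the subtrees of all children but `u` side by side in the rows `1, …, h`
starting with the column `x`, and the subtree of `u` outside of that shelf. -/
theorem CanDraw.shelf {u : V} {x0 x h : ℤ} {s : ℕ} {pu : ℤ × ℤ} {Ru R : Set (ℝ × ℝ)}
    (hu : u ∈ T.ch v) (hs : T.sz v = 1 + T.sz u + s) (hx : x ≤ x0) (hh : 1 ≤ h)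
    (hlight : ∀ c ∈ T.ch v, c ≠ u → ∀ o : ℤ, T.CanDraw ρ c (o, 1) (box o 1 (T.sz c) h))
    (hdu : T.CanDraw ρ u pu Ru)
    (hRu : ∀ z ∈ Ru, z.2 < h + 1 → (x0 : ℝ) < z.1 ∧ (x + s - 1 : ℝ) < z.1)
    -- The two uses: `u` follows in the same row, or `v` stands to the right of the whole shelf and
    -- `u` hangs vertically below it.
    (hsu : pu.2 = 0 ∨ pu.1 = x0 ∧ x + s ≤ x0)
    (hend : ∀ p ∈ gridSeg (x0, 0) pu, p ∈ Ru → p = gridPoint pu)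
    (hρ : ∀ o : ℤ, x ≤ o → ρ (x0, 0) (o, 1)) (hρu : ρ (x0, 0) pu)
    (hOR : gridPoint (x0, 0) ∈ R) (hsR : gridSeg (x0, 0) pu ⊆ R) (hRR : Ru ⊆ R)
    (hR : ∀ z : ℝ × ℝ, 0 < z.2 → z.2 ≤ h → (x : ℝ) ≤ z.1 →
      z.1 ≤ x0 ∨ z.1 ≤ x + s - 1 → z ∈ R) :
    T.CanDraw ρ v (x0, 0) R := by
  obtain ⟨o, ho, hoo⟩ := exists_offsets ((T.ch v).erase u) T.sz
  have hs' : ∑ c ∈ (T.ch v).erase u, T.sz c = s := by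
    have := sz_eq_add_erase hu
    omega
  rw [hs'] at ho
  have hxR : (x : ℝ) ≤ x0 := by exact_mod_cast hx
  have hhR : (1 : ℝ) ≤ h := by exact_mod_cast hh
  have hoR : ∀ c ∈ T.ch v, c ≠ u → (o c + T.sz c : ℝ) ≤ s := fun c hc hcu => by
    exact_mod_cast ho c (mem_erase.2 ⟨hcu, hc⟩)
  have hszR : ∀ c, (1 : ℝ) ≤ T.sz c := fun c => by exact_mod_cast sz_pos c
  let P : V → ℤ × ℤ := fun c => if c = u then pu else (x + o c, 1)
  let Rc : V → Set (ℝ × ℝ) := fun c => if c = u then Ru else box (x + o c) 1 (T.sz c) h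
  have Pu : P u = pu := if_pos rfl
  have Ru' : Rc u = Ru := if_pos rfl
  have Pc : ∀ c, c ≠ u → P c = (x + o c, 1) := fun c hc => if_neg hc
  have Rc' : ∀ c, c ≠ u → Rc c = box (x + o c) 1 (T.sz c) h := fun c hc => if_neg hc
  -- the segment to a child on the shelf
  have segc : ∀ c ∈ T.ch v, c ≠ u → ∀ p ∈ gridSeg (x0, 0) (x + o c, 1), 0 ≤ p.2 ∧ p.2 ≤ 1 ∧
      (x : ℝ) ≤ p.1 ∧ (p.1 ≤ x0 ∨ p.1 ≤ x + s - 1) ∧ (p.2 = 0 → p = gridPoint (x0, 0)) ∧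
      (p.2 = 1 → p = gridPoint (x + o c, 1)) := by
    intro c hc hcu p hp
    obtain ⟨t, h0, h1, e1, e2⟩ := mem_gridSeg.1 hp
    have h3 := hoR c hc hcu
    have h4 := hszR c
    push_cast at e1 e2
    have hto : 0 ≤ t * (o c : ℝ) := by positivity
    have e2 : p.2 = t := by linarith
    refine ⟨by linarith, by linarith, by nlinarith, ?_, ?_, ?_⟩
    · rcases le_total ((x : ℝ) + o c) x0 with hle | hle
      · left; nlinarith
      · right; nlinarith
    · intro h
      rw [h] at e2
      subst e2
      ext
      · rw [e1]; simp [gridPoint]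
      · rw [h]; simp [gridPoint]
    · intro h
      rw [h] at e2
      subst e2
      ext
      · rw [e1]; simp [gridPoint]
      · rw [h]; simp [gridPoint]
  -- the segment to `u`
  have segu : ∀ p ∈ gridSeg (x0, 0) pu, p.2 = 0 ∨ p.1 = x0 ∧ (x + s : ℝ) ≤ x0 := by
    intro p hp
    obtain ⟨t, h0, h1, e1, e2⟩ := mem_gridSeg.1 hp
    rcases hsu with h | ⟨h, h'⟩
    · left; rw [e2, h]; simp
    · right
      refine ⟨by rw [e1, h]; simp, by exact_mod_cast h'⟩
  have boxmem : ∀ c ∈ T.ch v, c ≠ u → ∀ p ∈ box (x + o c) 1 (T.sz c) h,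
      1 ≤ p.2 ∧ p.2 ≤ h ∧ (x : ℝ) ≤ p.1 ∧ p.1 ≤ x + s - 1 := by
    rintro c hc hcu p ⟨a1, a2, a3, a4⟩
    have h3 := hoR c hc hcu
    have : (0 : ℝ) ≤ o c := by positivity
    push_cast at *
    exact ⟨by linarith, by linarith, by linarith, by linarith⟩
  have apu : ∀ c ∈ T.ch v, c ≠ u → Apart (x0, 0) (P u) (P c) (Rc u) (Rc c) := by
    intro c hc hcu
    rw [Pu, Ru', Pc c hcu, Rc' c hcu]
    refine ⟨?_, ?_, ?_, ?_⟩
    · intro p hp hp'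
      have h1 := boxmem c hc hcu p hp'
      have := hRu p hp (by linarith)
      linarith
    · intro p hp hp'
      have h1 := boxmem c hc hcu p hp'
      rcases segu p hp with h | ⟨h, h'⟩ <;> linarith
    · intro p hp hp'
      have h1 := segc c hc hcu p hp
      have := hRu p hp' (by linarith)
      rcases h1.2.2.2.1 with h | h <;> linarith
    · intro p hp hp'
      have h1 := segc c hc hcu p hp'
      rcases segu p hp with h | ⟨h, h'⟩
      · exact h1.2.2.2.2.1 h
      · obtain ⟨t, h0, h1, e1, e2⟩ := mem_gridSeg.1 hp'
        have h3 := hoR c hc hcu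
        have h4 := hszR c
        push_cast at e1 e2
        have : t * ((x + o c : ℝ) - x0) = 0 := by linarith
        rcases mul_eq_zero.1 this with ht | ht
        · exact (segc c hc hcu p hp').2.2.2.2.1 (by rw [e2, ht]; simp)
        · linarith
  refine CanDraw.merge (P := P) (Rc := Rc) ?_ ?_ ?_ ?_ ?_ hOR ?_ ?_
  · intro c hc
    by_cases hcu : c = u
    · rw [hcu, Pu, Ru']; exact hdu
    · rw [Pc c hcu, Rc' c hcu]; exact hlight c hc hcu _
  · intro c hc hO
    by_cases hcu : c = u
    · rw [hcu, Ru'] at hO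
      have := (hRu _ hO (by simp [gridPoint]; linarith)).1
      simp [gridPoint] at this
    · rw [Rc' c hcu] at hO
      have := (boxmem c hc hcu _ hO).1
      simp [gridPoint] at this
      linarith
  · intro c hc p hp hp'
    by_cases hcu : c = u
    · rw [hcu, Pu] at hp
      rw [hcu, Ru'] at hp'
      rw [hcu, Pu]
      exact hend p hp hp'
    · rw [Pc c hcu] at hp ⊢
      rw [Rc' c hcu] at hp'
      have h1 := segc c hc hcu p hp
      have h2 := boxmem c hc hcu p hp'
      exact h1.2.2.2.2.2 (le_antisymm h1.2.1 h2.1)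
  · intro c hc c' hc' hcc
    by_cases hcu : c = u
    · subst hcu
      exact apu c' hc' (Ne.symm hcc)
    · by_cases hcu' : c' = u
      · subst hcu'
        exact (apu c hc hcc).symm
      · rw [Pc c hcu, Rc' c hcu, Pc c' hcu', Rc' c' hcu']
        refine apart_of_mem_row (by exact_mod_cast sz_pos c) (by exact_mod_cast sz_pos c') ?_
        have := hoo c (mem_erase.2 ⟨hcu, hc⟩) c' (mem_erase.2 ⟨hcu', hc'⟩) hcc
        omega
  · intro c hc
    by_cases hcu : c = u
    · rw [hcu, Pu]; exact hρu
    · rw [Pc c hcu]; exact hρ _ (by omega)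
  · intro c hc
    by_cases hcu : c = u
    · rw [hcu, Pu]; exact hsR
    · rw [Pc c hcu]
      intro p hp
      obtain ⟨h1, h2, h3, h4, h5, -⟩ := segc c hc hcu p hp
      rcases h1.eq_or_lt with h | h
      · rw [h5 h.symm]; exact hOR
      · exact hR p h (by linarith) h3 h4
  · intro c hc
    by_cases hcu : c = u
    · rw [hcu, Ru']; exact hRR
    · rw [Rc' c hcu]
      intro p hp
      obtain ⟨h1, h2, h3, h4⟩ := boxmem c hc hcu p hp
      exact hR p (by linarith) h2 h3 (Or.inr h4)

theorem CanDraw.leaf {O : ℤ × ℤ} {R : Set (ℝ × ℝ)} (h : T.ch v = ∅) (hO : gridPoint O ∈ R) :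
    T.CanDraw ρ v O R := by
  refine CanDraw.merge (P := fun _ => O) (Rc := fun _ => ∅) ?_ ?_ ?_ ?_ ?_ hO ?_ ?_ <;> simp [h]

/-- Both coordinates increase. -/
def Increasing (p q : ℤ × ℤ) : Prop := p.1 ≤ q.1 ∧ p.2 ≤ q.2

theorem CanDraw.translate_increasing {O : ℤ × ℤ} {x y w h : ℤ}
    (hd : T.CanDraw Increasing v O (box x y w h)) (a b : ℤ) :
    T.CanDraw Increasing v (a + O.1, b + O.2) (box (a + x) (b + y) w h) := by
  have := hd.map (ρ' := Increasing) (R' := box (a + x) (b + y) w h) a b 1 0 (Or.inl rfl) ?_ ?_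
  · simpa using this
  · rintro p q ⟨h1, h2⟩
    constructor <;> simp <;> assumption
  · rintro p ⟨h1, h2, h3, h4⟩
    refine ⟨?_, ?_, ?_, ?_⟩ <;> push_cast <;> linarith

open Classical in
/-- Every tree with `n` vertices has a drawing with `n` columns and `log₂ n + 1` rows. -/
theorem canDraw_log (v : V) :
    T.CanDraw Increasing v (0, 0) (box 0 0 (T.sz v) (Nat.log 2 (T.sz v) + 1)) := by
  induction hn : T.sz v using Nat.strong_induction_on generalizing v with
  | _ n ih =>
    subst hn
    by_cases hch : T.ch v = ∅
    · refine CanDraw.leaf hch ?_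
      have := sz_pos (T := T) v
      have h1 : (1 : ℝ) ≤ T.sz v := by exact_mod_cast this
      refine ⟨?_, ?_, ?_, ?_⟩ <;> simp [gridPoint]
      · linarith
    · obtain ⟨u, hu, hmax⟩ := exists_max_image (T.ch v) T.sz (nonempty_iff_ne_empty.2 hch)
      have hsz := sz_eq_add_erase hu
      set s := ∑ c ∈ (T.ch v).erase u, T.sz c with hs
      have hsu := sz_pos (T := T) u
      have hlog : 1 ≤ Nat.log 2 (T.sz v) := Nat.le_log_of_pow_le (by norm_num) (by omega)
      have hszR : (T.sz v : ℝ) = 1 + T.sz u + s := by exact_mod_cast hsz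
      have hlogR : (1 : ℝ) ≤ (Nat.log 2 (T.sz v) : ℕ) := by exact_mod_cast hlog
      have hsuR : (1 : ℝ) ≤ T.sz u := by exact_mod_cast hsu
      have hs0 : (0 : ℝ) ≤ s := by positivity
      have hdu := (ih (T.sz u) (sz_ch_lt hu) u rfl).translate_increasing (s + 1) 0
      have hbox : box (s + 1 + 0) (0 + 0) (T.sz u) (Nat.log 2 (T.sz u) + 1) ⊆
          box (s + 1) 0 (T.sz u) (Nat.log 2 (T.sz v) + 1) := by
        have : Nat.log 2 (T.sz u) ≤ Nat.log 2 (T.sz v) := Nat.log_mono_right (sz_ch_lt hu).le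
        exact box_subset (by omega) (by omega) (by omega) (by omega)
      refine CanDraw.shelf (u := u) (x0 := 0) (x := 0) (h := Nat.log 2 (T.sz v)) (s := s)
        (pu := (s + 1, 0)) (Ru := box (s + 1) 0 (T.sz u) (Nat.log 2 (T.sz v) + 1)) hu hsz le_rfl
        (by exact_mod_cast hlog) ?_ (by simpa using hdu.mono hbox) ?_ (Or.inl rfl) ?_ ?_ ?_ ?_ ?_ ?_ ?_
      · intro c hc hcu o
        have h1 : T.sz c ≤ T.sz u := hmax c hc
        have h2 : T.sz c ≤ s :=
          single_le_sum (f := T.sz) (fun _ _ => Nat.zero_le _) (mem_erase.2 ⟨hcu, hc⟩)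
        -- A child other than the heaviest has less than half of the vertices; the row saved is row
        -- 0.
        have h3 : Nat.log 2 (T.sz c) + 1 ≤ Nat.log 2 (T.sz v) := by
          have h0 := sz_pos (T := T) c
          rw [← Nat.log_mul_base (by norm_num) (by omega)]
          exact Nat.log_mono_right (by omega)
        have := (ih (T.sz c) (sz_ch_lt hc) c rfl).translate_increasing o 1
        simp only [add_zero] at this
        exact this.mono (box_subset le_rfl le_rfl le_rfl (by omega))
      · rintro z ⟨h1, h2, h3, h4⟩ -
        push_cast at *
        constructor <;> linarith
      · rintro p hp ⟨h1, h2, h3, h4⟩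
        obtain ⟨t, h0, ht1, e1, e2⟩ := mem_gridSeg.1 hp
        push_cast at *
        have : t = 1 := by nlinarith
        subst this
        ext
        · rw [e1]; simp [gridPoint]
        · rw [e2]; simp [gridPoint]
      · intro o ho
        exact ⟨ho, by norm_num⟩
      · exact ⟨by simp; omega, le_rfl⟩
      · refine ⟨?_, ?_, ?_, ?_⟩ <;> simp [gridPoint]
        · linarith
      · intro p hp
        obtain ⟨t, h0, ht1, e1, e2⟩ := mem_gridSeg.1 hp
        push_cast at *
        refine ⟨?_, ?_, ?_, ?_⟩ <;> push_cast
        · nlinarith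
        · nlinarith
        · linarith
        · linarith
      · exact box_subset (by omega) (by omega) (by omega) (by omega)
      · intro z h1 h2 h3 h4
        push_cast at *
        refine ⟨?_, ?_, ?_, ?_⟩ <;> push_cast
        · linarith
        · rcases h4 with h4 | h4 <;> linarith
        · linarith
        · linarith

end ParentTree

/-! ### Fans of sheared squares visible from the origin -/

/-- The image of a square with `a` columns and `a` rows of grid points under the shear of slope `k`,
with its corner at the grid point `P`. -/
def slab (P : ℤ × ℤ) (k a : ℤ) : Set (ℝ × ℝ) :=
  {p | (P.1 : ℝ) ≤ p.1 ∧ p.1 ≤ P.1 + a - 1 ∧ 0 ≤ p.2 - P.2 - k * (p.1 - P.1) ∧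
    p.2 - P.2 - k * (p.1 - P.1) ≤ a - 1}

theorem gridPoint_mem_slab {P : ℤ × ℤ} {k a : ℤ} (ha : 1 ≤ a) : gridPoint P ∈ slab P k a := by
  have : (1 : ℝ) ≤ a := by exact_mod_cast ha
  refine ⟨?_, ?_, ?_, ?_⟩ <;> simp [gridPoint] <;> linarith

theorem mem_gridSeg_zero {P : ℤ × ℤ} {p : ℝ × ℝ} : p ∈ gridSeg (0, 0) P ↔
    ∃ t : ℝ, 0 ≤ t ∧ t ≤ 1 ∧ p.1 = t * P.1 ∧ p.2 = t * P.2 := by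
  rw [mem_gridSeg]; simp

namespace ParentTree

/-- Two slabs whose corners lie on a common line not through the origin do not interfere. -/
theorem apart_of_same_level {P P' : ℤ × ℤ} {k a a' q p E : ℤ} (hq : 0 < q) (hE : 0 < E)
    (hP : q * P.2 - p * P.1 = E) (hP' : q * P'.2 - p * P'.1 = E) (hk : p ≤ k * q)
    (hX' : 0 < P'.1) (hX : P'.1 + a' ≤ P.1) (ha' : 1 ≤ a') :
    Apart (0, 0) P P' (slab P k a) (slab P' k a') := by
  have hq : (0 : ℝ) < q := by exact_mod_cast hq
  have hE : (0 : ℝ) < E := by exact_mod_cast hE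
  have hP : (q : ℝ) * P.2 - p * P.1 = E := by exact_mod_cast hP
  have hP' : (q : ℝ) * P'.2 - p * P'.1 = E := by exact_mod_cast hP'
  have hk : (p : ℝ) ≤ k * q := by exact_mod_cast hk
  have hX' : (0 : ℝ) < P'.1 := by exact_mod_cast hX'
  have hX : (P'.1 + a' : ℝ) ≤ P.1 := by exact_mod_cast hX
  have ha' : (1 : ℝ) ≤ a' := by exact_mod_cast ha'
  refine ⟨?_, ?_, ?_, ?_⟩
  · rintro z ⟨h1, h2, h3, h4⟩ ⟨h1', h2', h3', h4'⟩
    linarith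
  · rintro z hz ⟨h1', h2', h3', h4'⟩
    obtain ⟨t, h0, h1, e1, e2⟩ := mem_gridSeg_zero.1 hz
    -- The level `q y - p x` equals `t * E` along the edge and is at least `E` on the other slab,
    -- because `k ≥ p / q`. So they could meet only at the end of the edge, which lies in other
    -- columns.
    have hl : (q : ℝ) * z.2 - p * z.1 = t * E := by rw [e1, e2, ← hP]; ring
    have hl' : (q : ℝ) * z.2 - p * z.1 = E + q * (z.2 - P'.2 - k * (z.1 - P'.1)) +
        (k * q - p) * (z.1 - P'.1) := by rw [← hP']; ring
    have h5 : 0 ≤ q * (z.2 - P'.2 - k * (z.1 - P'.1)) := mul_nonneg hq.le h3'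
    have h6 : 0 ≤ (k * q - p) * (z.1 - P'.1) := mul_nonneg (by linarith) (by linarith)
    have : 1 ≤ t := by
      by_contra h
      push Not at h
      have := mul_lt_mul_of_pos_right h hE
      linarith
    have : t = 1 := le_antisymm h1 this
    rw [this] at e1
    linarith
  · rintro z hz ⟨h1', h2', h3', h4'⟩
    obtain ⟨t, h0, h1, e1, e2⟩ := mem_gridSeg_zero.1 hz
    have := mul_le_mul_of_nonneg_right h1 hX'.le
    linarith
  · intro z hz hz'
    obtain ⟨t, h0, h1, e1, e2⟩ := mem_gridSeg_zero.1 hz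
    obtain ⟨t', h0', h1', e1', e2'⟩ := mem_gridSeg_zero.1 hz'
    have hl : (q : ℝ) * z.2 - p * z.1 = t * E := by rw [e1, e2, ← hP]; ring
    have hl' : (q : ℝ) * z.2 - p * z.1 = t' * E := by rw [e1', e2', ← hP']; ring
    have ht : t = t' := mul_right_cancel₀ hE.ne' (by linarith)
    subst ht
    have : t * (P.1 - P'.1 : ℝ) = 0 := by linarith
    rcases mul_eq_zero.1 this with h | h
    · subst h
      ext
      · rw [e1]; simp [gridPoint]
      · rw [e2]; simp [gridPoint]
    · linarith

/-- Regions separated by a line through the origin do not interfere. -/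
theorem apart_of_slope {P P' : ℤ × ℤ} {R R' : Set (ℝ × ℝ)} (s : ℝ) (hP : gridPoint P ∈ R)
    (hP' : gridPoint P' ∈ R') (hR : ∀ p ∈ R, 0 < p.1 ∧ p.2 ≤ s * p.1)
    (hR' : ∀ p ∈ R', 0 < p.1 ∧ s * p.1 < p.2) : Apart (0, 0) P P' R R' := by
  have h := (hR _ hP).2
  have h' := (hR' _ hP').2
  simp only [gridPoint] at h h'
  have key : ∀ z ∈ gridSeg (0, 0) P, z.2 ≤ s * z.1 := by
    intro z hz
    obtain ⟨t, h0, h1, e1, e2⟩ := mem_gridSeg_zero.1 hz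
    rw [e1, e2]
    nlinarith
  have key' : ∀ z ∈ gridSeg (0, 0) P', z.2 ≤ s * z.1 → z = gridPoint (0, 0) := by
    intro z hz hz'
    obtain ⟨t, h0, h1, e1, e2⟩ := mem_gridSeg_zero.1 hz
    rcases h0.eq_or_lt with h | h
    · subst h
      ext
      · rw [e1]; simp [gridPoint]
      · rw [e2]; simp [gridPoint]
    · rw [e1, e2] at hz'
      have := mul_lt_mul_of_pos_left h' h
      linarith
  refine ⟨?_, ?_, ?_, ?_⟩
  · intro z hz hz'
    linarith [(hR z hz).2, (hR' z hz').2]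
  · intro z hz hz'
    linarith [key z hz, (hR' z hz').2]
  · intro z hz hz'
    have h1 := hR z hz'
    have := key' z hz h1.2
    rw [this] at h1
    simp [gridPoint] at h1
  · intro z hz hz'
    exact key' z hz' (key z hz)

theorem eq_of_mem_gridSeg_zero {P : ℤ × ℤ} {R : Set (ℝ × ℝ)} (hP : 0 < P.1)
    (hR : ∀ z ∈ R, (P.1 : ℝ) ≤ z.1) : ∀ z ∈ gridSeg (0, 0) P, z ∈ R → z = gridPoint P := by
  intro z hz hzR
  obtain ⟨t, h0, h1, e1, e2⟩ := mem_gridSeg_zero.1 hz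
  have hP : (0 : ℝ) < P.1 := by exact_mod_cast hP
  have := hR z hzR
  have : t = 1 := by
    refine le_antisymm h1 ?_
    by_contra h
    push Not at h
    have := mul_lt_mul_of_pos_right h hP
    linarith
  subst this
  ext
  · rw [e1]; simp [gridPoint]
  · rw [e2]; simp [gridPoint]

/-- A placement of the slabs of sizes `a i`, for `i ∈ [n₀, n₁)`, that are visible from the origin, with
all slopes in `(σ, σ']`. -/
structure Fan (Q : ℕ) (a : ℕ → ℕ) (n₀ n₁ : ℕ) (σ σ' : ℝ) (P : ℕ → ℤ × ℤ) (k : ℕ → ℤ) : Prop where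
  shear : ∀ i, n₀ ≤ i → i < n₁ → 0 ≤ k i
  mem : ∀ i, n₀ ≤ i → i < n₁ → ∀ p ∈ slab (P i) (k i) (a i),
    (4 * Q ^ 2 : ℝ) ≤ p.1 ∧ p.1 ≤ 16 * Q ^ 2 ∧ σ * p.1 < p.2 ∧ p.2 ≤ σ' * p.1
  apart : ∀ i j, n₀ ≤ i → i < j → j < n₁ →
    Apart (0, 0) (P i) (P j) (slab (P i) (k i) (a i)) (slab (P j) (k j) (a j))

/-- Greedy filling: slabs, with widths rounded up to multiples of `q`, are added until they exceed
`8 * Q ^ 2` columns. The overshoot is at most one slab, so a sector starting at column `16 * Q ^ 2`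
stays to the right of column `4 * Q ^ 2`. -/
theorem exists_fan_end (Q : ℕ) (m : ℕ → ℕ) (q : ℕ) (hm : ∀ i, m i * q ≤ 2 * Q)
    {n₀ N : ℕ} (h : n₀ < N) : ∃ n₁, n₀ < n₁ ∧ n₁ ≤ N ∧
      (∑ i ∈ Ico n₀ n₁, m i * q ≤ 8 * Q ^ 2 + 2 * Q) ∧
      (n₁ = N ∨ 8 * Q ^ 2 < ∑ i ∈ Ico n₀ n₁, m i * q) := by
  obtain ⟨d, rfl⟩ := Nat.exists_eq_add_of_lt h
  clear h
  induction d with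
  | zero =>
    refine ⟨n₀ + 1, by omega, by omega, ?_, Or.inl rfl⟩
    have := hm n₀
    simp
    nlinarith
  | succ d ih =>
    obtain ⟨n₁, h1, h2, h3, h4⟩ := ih
    by_cases h5 : 8 * Q ^ 2 < ∑ i ∈ Ico n₀ n₁, m i * q
    · exact ⟨n₁, h1, by omega, h3, Or.inr h5⟩
    · have h6 : n₁ = n₀ + d + 1 := h4.resolve_right h5
      refine ⟨n₁ + 1, by omega, by omega, ?_, Or.inl (by omega)⟩
      rw [sum_Ico_succ_top (by omega)]
      have := hm n₁
      omega

set_option maxHeartbeats 1000000 in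
/-- One sector of a fan, along a direction of small denominator. -/
theorem exists_sector (Q : ℕ) (hQ : 1 ≤ Q) (a : ℕ → ℕ) (ha : Antitone a) (haQ : ∀ i, a i ≤ Q)
    {n₀ N : ℕ} (hN : n₀ < N) (ha1 : ∀ i < N, 1 ≤ a i) (σ : ℝ) (hσ : 0 ≤ σ) :
    ∃ (n₁ q : ℕ) (σ' : ℝ) (P : ℕ → ℤ × ℤ) (k : ℕ → ℤ), n₀ < n₁ ∧ n₁ ≤ N ∧ 1 ≤ q ∧ σ ≤ σ' ∧
      σ' ≤ σ + 4 / (q * Q) + 3 * a n₀ / (4 * Q ^ 2) ∧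
      (n₁ = N ∨ 8 * Q ^ 2 ≤ q * ∑ i ∈ Ico n₀ n₁, a i ∧ 8 * Q ^ 2 ≤ 2 * Q * (n₁ - n₀)) ∧
      Fan Q a n₀ n₁ σ σ' P k := by
  -- Dirichlet approximation. The denominator matters because lattice points on a line of slope `p /
  -- q` recur only every `q` columns.
  obtain ⟨p, q', hq0, hqQ, hpq⟩ := Real.exists_int_int_abs_mul_sub_le σ (n := Q) (by omega)
  lift q' to ℕ using hq0.le with q
  have hq : 1 ≤ q := by exact_mod_cast hq0
  have hqQ : q ≤ Q := by exact_mod_cast hqQ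
  have hQR : (1 : ℝ) ≤ Q := by exact_mod_cast hQ
  have hqR : (1 : ℝ) ≤ q := by exact_mod_cast hq
  have hp0 : 0 ≤ p := by
    have h1 := (abs_le.1 hpq).2
    have h2 : (1 : ℝ) / (Q + 1) < 1 := by rw [div_lt_one (by linarith)]; linarith
    have h3 : (0 : ℝ) ≤ ((q : ℤ) : ℝ) * σ := by positivity
    have : (-1 : ℝ) < p := by linarith
    have : (-1 : ℤ) < p := by exact_mod_cast this
    omega
  set r : ℝ := p / q with hr
  have hrq : (q : ℝ) * r = p := by rw [hr]; field_simp
  have hδ : |σ - r| ≤ 1 / (q * Q) := by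
    have h1 : |σ - r| = |(q : ℝ) * σ - p| / q := by
      rw [← hrq, ← mul_sub, abs_mul, abs_of_pos (by linarith : (0 : ℝ) < q)]
      field_simp
    rw [h1, div_le_iff₀ (by linarith)]
    have h2 : (1 : ℝ) / (Q + 1) ≤ 1 / Q := one_div_le_one_div_of_le (by linarith) (by linarith)
    have h3 : 1 / (q * Q : ℝ) * q = 1 / Q := by field_simp
    rw [h3]
    exact le_trans (by simpa using hpq) h2
  set s := max σ r with hs
  -- The first integer above the line of slope `s` at the right border. Going left with slope `r ≤
  -- s` stays above that line, hence above slope `σ`.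
  set Yb : ℤ := ⌊s * (16 * Q ^ 2)⌋ + 1 with hYb
  have hYb1 : s * (16 * Q ^ 2) < Yb := by rw [hYb]; push_cast; exact Int.lt_floor_add_one _
  have hYb2 : (Yb : ℝ) ≤ s * (16 * Q ^ 2) + 1 := by
    rw [hYb]; push_cast; linarith [Int.floor_le (s * (16 * (Q : ℝ) ^ 2))]
  -- The shear is an integer in `[r, r + 1]`: at least `r` keeps the slab above the line of corners,
  -- at most `r + 1` lets it rise by less than twice its size.
  obtain ⟨k, hk1, hk2⟩ : ∃ k : ℤ, p ≤ k * q ∧ k * q ≤ p + q := by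
    refine ⟨p / q + 1, ?_, ?_⟩
    · have := Int.emod_add_mul_ediv p q
      have := Int.emod_lt_of_pos p hq0
      nlinarith
    · have := Int.emod_add_mul_ediv p q
      have := Int.emod_nonneg p hq0.ne'
      nlinarith
  have hk0 : 0 ≤ k := by
    by_contra h
    have : k * q < 0 := mul_neg_of_neg_of_pos (by omega) hq0
    omega
  let m : ℕ → ℕ := fun i => (a i + q - 1) / q
  have hm1 : ∀ i, a i ≤ m i * q := fun i => by
    have h1 := Nat.div_add_mod (a i + q - 1) q
    have h2 := Nat.mod_lt (a i + q - 1) (by omega : 0 < q)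
    have h3 : m i * q = q * ((a i + q - 1) / q) := mul_comm _ _
    omega
  have hm2 : ∀ i, m i * q ≤ a i + q - 1 := fun i => Nat.div_mul_le_self _ _
  obtain ⟨n₁, hn1, hn2, hn3, hn4⟩ := exists_fan_end Q m q
    (fun i => by have := hm2 i; have := haQ i; omega) hN
  let M : ℕ → ℕ := fun n => ∑ i ∈ Ico n₀ n, m i
  have hT : ∀ n, ∑ i ∈ Ico n₀ n, m i * q = M n * q := fun n => (sum_mul ..).symm
  have hMsucc : ∀ n, n₀ ≤ n → M (n + 1) = M n + m n := fun n hn => sum_Ico_succ_top hn _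
  have hMmono : Monotone M := fun i j hij =>
    sum_le_sum_of_subset (Ico_subset_Ico le_rfl hij)
  rw [hT] at hn3 hn4
  -- A slab extends to the right of its corner, so its own `m i` steps by `(q, p)` are taken before
  -- the corner is set; hence `M (i + 1)`.
  let P : ℕ → ℤ × ℤ := fun i => (16 * Q ^ 2 - M (i + 1) * q, Yb - p * M (i + 1))
  set E : ℤ := q * Yb - p * (16 * Q ^ 2) with hE
  have hPE : ∀ i, (q : ℤ) * (P i).2 - p * (P i).1 = E := fun i => by
    simp only [P, hE]; ring
  set e : ℝ := Yb - r * (16 * Q ^ 2) with he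
  have hEe : (E : ℝ) = q * e := by
    rw [hE, he]; push_cast; rw [← hrq]; ring
  have hrs : r ≤ s := le_max_right _ _
  have hQ2 : (1 : ℝ) ≤ Q ^ 2 := one_le_pow₀ hQR
  have he0 : 0 < e := by
    have : r * (16 * Q ^ 2) ≤ s * (16 * Q ^ 2) := mul_le_mul_of_nonneg_right hrs (by positivity)
    linarith
  have hE0 : 0 < E := by
    have : (0 : ℝ) < E := by rw [hEe]; positivity
    exact_mod_cast this
  have hXlow : ∀ i, i < n₁ → 4 * (Q : ℤ) ^ 2 ≤ (P i).1 := fun i hi => by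
    have h1 : M (i + 1) * q ≤ M n₁ * q := Nat.mul_le_mul_right _ (hMmono hi)
    have h2 : M (i + 1) * q ≤ 8 * Q ^ 2 + 2 * Q := h1.trans hn3
    have h3 : (M (i + 1) * q : ℤ) ≤ 8 * Q ^ 2 + 2 * Q := by exact_mod_cast h2
    have h4 : (Q : ℤ) ≤ Q ^ 2 := by exact_mod_cast Nat.le_self_pow (by norm_num) Q
    simp only [P]
    linarith
  have hXhigh : ∀ i, n₀ ≤ i → (P i).1 + a i ≤ 16 * (Q : ℤ) ^ 2 := fun i hi => by
    have h1 : a i ≤ M (i + 1) * q := by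
      rw [hMsucc i hi, add_mul]
      exact (hm1 i).trans (Nat.le_add_left _ _)
    have h3 : (a i : ℤ) ≤ M (i + 1) * q := by exact_mod_cast h1
    simp only [P]
    linarith
  have ha0 : (1 : ℝ) ≤ a n₀ := by exact_mod_cast ha1 n₀ hN
  -- Slab points are at most `e + 2 * a n₀` above the line of slope `r` through the origin, at
  -- abscissa at least `4 * Q ^ 2`.
  set σ' : ℝ := r + (e + 2 * a n₀) / (4 * Q ^ 2) with hσ'
  have hδ' := abs_le.1 hδ
  have hσσ' : s ≤ σ' := by
    have h1 : (s - r) * (16 * Q ^ 2) ≤ e := by rw [he]; linarith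
    have h2 : (s - r) * (4 * Q ^ 2) ≤ e + 2 * a n₀ := by
      have : 0 ≤ (s - r) * (12 * Q ^ 2) := mul_nonneg (by linarith) (by positivity)
      linarith
    have : s - r ≤ (e + 2 * a n₀) / (4 * Q ^ 2) := by
      rw [le_div_iff₀ (by positivity)]; exact h2
    linarith
  have hupper : σ' ≤ σ + 4 / (q * Q) + 3 * a n₀ / (4 * Q ^ 2) := by
    have h0 : (4 : ℝ) / (q * Q) = 4 * (1 / (q * Q)) := by ring
    have h1 : 0 ≤ 1 / (q * Q : ℝ) := by positivity
    have h2 : e ≤ (s - r) * (16 * Q ^ 2) + 1 := by rw [he]; linarith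
    have h3 : (e + 2 * a n₀) / (4 * Q ^ 2) ≤ 4 * (s - r) + 3 * a n₀ / (4 * Q ^ 2) := by
      rw [div_le_iff₀ (by positivity), add_mul, div_mul_cancel₀ _ (by positivity)]
      linarith
    rw [hσ', h0]
    rcases le_total σ r with h | h
    · have : s = r := max_eq_right h
      rw [this] at h3
      linarith
    · have : s = σ := max_eq_left h
      rw [this] at h3
      linarith
  refine ⟨n₁, q, σ', P, fun _ => k, hn1, hn2, hq, (le_max_left _ _).trans hσσ', hupper, ?_, ?_⟩
  · refine hn4.imp id fun h => ⟨?_, ?_⟩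
    · rw [mul_sum]
      refine h.le.trans ?_
      rw [← hT]
      refine sum_le_sum fun i hi => (hm2 i).trans ?_
      have := ha1 i (by rw [mem_Ico] at hi; omega)
      -- Here `a i + q - 1 ≤ q * a i`, since `(a i - 1) * (q - 1) ≥ 0`.
      obtain ⟨b, hb⟩ := Nat.exists_eq_add_of_le this
      obtain ⟨c, rfl⟩ := Nat.exists_eq_add_of_le hq
      rw [hb]
      have : (1 + c) * (1 + b) = 1 + b + c + c * b := by ring
      omega
    · refine h.le.trans ?_
      rw [← hT]
      have : ∑ i ∈ Ico n₀ n₁, m i * q ≤ ∑ i ∈ Ico n₀ n₁, 2 * Q :=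
        sum_le_sum fun i _ => (hm2 i).trans (by have := haQ i; omega)
      simpa [mul_comm] using this
  · refine ⟨fun _ _ _ => hk0, ?_, ?_⟩
    · rintro i hi hi' z ⟨h1, h2, h3, h4⟩
      have hX1 : (4 * Q ^ 2 : ℝ) ≤ (P i).1 := by exact_mod_cast hXlow i hi'
      have hX2 : ((P i).1 + a i : ℝ) ≤ 16 * Q ^ 2 := by exact_mod_cast hXhigh i hi
      have hai : (a i : ℝ) ≤ a n₀ := by exact_mod_cast ha hi
      have hPe : ((P i).2 : ℝ) - r * (P i).1 = e := by
        have h5 : (q : ℝ) * (P i).2 - p * (P i).1 = q * e := by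
          rw [← hEe]; exact_mod_cast hPE i
        rw [← hrq] at h5
        have h6 : (q : ℝ) * ((P i).2 - r * (P i).1) = q * e := by linarith
        exact mul_left_cancel₀ (by linarith) h6
      have hkr : 0 ≤ k - r ∧ k - r ≤ 1 := by
        have e1 : (p : ℝ) ≤ k * q := by exact_mod_cast hk1
        have e2 : (k * q : ℝ) ≤ p + q := by exact_mod_cast hk2
        rw [← hrq] at e1 e2
        constructor
        · by_contra hneg
          nlinarith
        · by_contra hneg
          nlinarith
      push_cast at h2 h4
      have hlev : z.2 - r * z.1 = e + (z.2 - (P i).2 - k * (z.1 - (P i).1)) +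
          (k - r) * (z.1 - (P i).1) := by rw [← hPe]; ring
      have hm0 : 0 ≤ (k - r) * (z.1 - (P i).1) := mul_nonneg hkr.1 (by linarith)
      have hm1 : (k - r) * (z.1 - (P i).1) ≤ 1 * (z.1 - (P i).1) :=
        mul_le_mul_of_nonneg_right hkr.2 (by linarith)
      have hz1 : (4 * Q ^ 2 : ℝ) ≤ z.1 := by linarith
      have hz2 : z.1 ≤ 16 * Q ^ 2 := by linarith
      refine ⟨hz1, hz2, ?_, ?_⟩
      · have h5 : (s - r) * z.1 ≤ (s - r) * (16 * Q ^ 2) :=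
          mul_le_mul_of_nonneg_left hz2 (by linarith)
        have h6 : σ * z.1 ≤ s * z.1 :=
          mul_le_mul_of_nonneg_right (le_max_left _ _) (by nlinarith)
        linarith
      · have h5 : e + 2 * a n₀ ≤ (e + 2 * a n₀) / (4 * Q ^ 2) * z.1 := by
          rw [div_mul_eq_mul_div, le_div_iff₀ (by positivity)]
          exact mul_le_mul_of_nonneg_left hz1 (by positivity)
        rw [hσ', add_mul]
        linarith
    · intro i j hi hij hj
      have hQ2' : 0 < 4 * (Q : ℤ) ^ 2 := by positivity
      refine apart_of_same_level hq0 hE0 (hPE i) (hPE j) hk1 (lt_of_lt_of_le hQ2' (hXlow j hj)) ?_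
        (by exact_mod_cast ha1 j (by omega))
      have h1 : M (i + 1) * q + a j ≤ M (j + 1) * q := by
        rw [hMsucc j (by omega), add_mul]
        exact add_le_add (Nat.mul_le_mul_right _ (hMmono hij)) (hm1 j)
      have h3 : (M (i + 1) * q + a j : ℤ) ≤ M (j + 1) * q := by exact_mod_cast h1
      simp only [P]
      linarith

/-- A complete fan. -/
theorem exists_fan (Q : ℕ) (hQ : 1 ≤ Q) (a : ℕ → ℕ) (ha : Antitone a) (haQ : ∀ i, a i ≤ Q)
    (N : ℕ) (ha1 : ∀ i < N, 1 ≤ a i) (n₀ : ℕ) (hn : n₀ ≤ N) (σ : ℝ) (hσ : 0 ≤ σ) :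
    ∃ (σ' : ℝ) (P : ℕ → ℤ × ℤ) (k : ℕ → ℤ), σ ≤ σ' ∧
      σ' ≤ σ + (∑ i ∈ Ico n₀ N, a i : ℕ) / Q ^ 3 + 3 * a n₀ / (4 * Q ^ 2) + 4 / Q ∧
      Fan Q a n₀ N σ σ' P k := by
  have hQR : (1 : ℝ) ≤ Q := by exact_mod_cast hQ
  induction hd : N - n₀ using Nat.strong_induction_on generalizing n₀ σ with
  | _ d ih =>
    rcases hn.eq_or_lt with rfl | hlt
    · refine ⟨σ, fun _ => (0, 0), fun _ => 0, le_rfl, ?_, ⟨fun i h1 h2 => absurd h2 (by omega),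
        fun i h1 h2 => absurd h2 (by omega), fun i j h1 h2 h3 => absurd h3 (by omega)⟩⟩
      have h1 : (0 : ℝ) ≤ (∑ i ∈ Ico n₀ n₀, a i : ℕ) / Q ^ 3 := by positivity
      have h2 : (0 : ℝ) ≤ 3 * a n₀ / (4 * Q ^ 2) := by positivity
      have h3 : (0 : ℝ) ≤ 4 / Q := by positivity
      linarith
    · obtain ⟨n₁, q, σ₁, P₁, k₁, hn1, hn2, hq, hσ1, hup, hcase, hF⟩ :=
        exists_sector Q hQ a ha haQ hlt ha1 σ hσ
      have hqR : (1 : ℝ) ≤ q := by exact_mod_cast hq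
      rcases hcase with rfl | ⟨hc1, hc2⟩
      · refine ⟨σ₁, P₁, k₁, hσ1, hup.trans ?_, hF⟩
        have h1 : (0 : ℝ) ≤ (∑ i ∈ Ico n₀ n₁, a i : ℕ) / Q ^ 3 := by positivity
        have h2 : (4 : ℝ) / (q * Q) ≤ 4 / Q :=
          div_le_div_of_nonneg_left (by norm_num) (by linarith) (by nlinarith)
        linarith
      · obtain ⟨σ₂, P₂, k₂, hσ2, hup2, hF2⟩ :=
          ih (N - n₁) (by omega) n₁ hn2 σ₁ (hσ.trans hσ1) rfl
        refine ⟨σ₂, fun i => if i < n₁ then P₁ i else P₂ i, fun i => if i < n₁ then k₁ i else k₂ i,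
          hσ1.trans hσ2, ?_, ?_⟩
        · have hsum : (∑ i ∈ Ico n₀ N, a i : ℕ) =
              ∑ i ∈ Ico n₀ n₁, a i + ∑ i ∈ Ico n₁ N, a i :=
            (sum_Ico_consecutive _ hn1.le hn2).symm
          set S := ∑ i ∈ Ico n₀ n₁, a i with hS
          have hS2 : (n₁ - n₀) * a n₁ ≤ S := by
            have : ∑ i ∈ Ico n₀ n₁, a n₁ ≤ S :=
              sum_le_sum fun i hi => ha (by rw [mem_Ico] at hi; omega)
            simpa using this
          have hc1R : (8 * Q ^ 2 : ℝ) ≤ q * S := by exact_mod_cast hc1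
          have hc2R : (8 * Q ^ 2 * a n₁ : ℝ) ≤ 2 * Q * S := by
            have : 8 * Q ^ 2 * a n₁ ≤ 2 * Q * S :=
              (Nat.mul_le_mul_right _ hc2).trans
                (by rw [mul_assoc]; exact Nat.mul_le_mul_left _ hS2)
            exact_mod_cast this
          -- Half of `S / Q ^ 3` pays for the direction of this full sector. The other half pays for
          -- the first slab of the next one: this sector has at least `4 * Q` slabs, none smaller.
          -- The last sector and the first slab remain as the additive terms.
          have e1 : (4 : ℝ) / (q * Q) ≤ S / (2 * Q ^ 3) := by
            rw [div_le_div_iff₀ (by positivity) (by positivity)]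
            nlinarith
          have e2 : (3 * a n₁ / (4 * Q ^ 2) : ℝ) ≤ S / (2 * Q ^ 3) := by
            rw [div_le_div_iff₀ (by positivity) (by positivity)]
            nlinarith [sq_nonneg (Q : ℝ)]
          have e3 : (S / (2 * Q ^ 3) + S / (2 * Q ^ 3) : ℝ) = S / Q ^ 3 := by field_simp; ring
          rw [hsum]
          push_cast
          rw [add_div]
          push_cast at hup2
          linarith
        · have hpos : (0 : ℝ) < 4 * Q ^ 2 := by positivity
          refine ⟨?_, ?_, ?_⟩
          · intro i h1 h2
            by_cases h : i < n₁
            · simp only [h, if_true]; exact hF.shear i h1 h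
            · simp only [h, if_false]; exact hF2.shear i (by omega) h2
          · intro i h1 h2 z hz
            by_cases h : i < n₁
            · simp only [h, if_true] at hz
              obtain ⟨e1, e2, e3, e4⟩ := hF.mem i h1 h z hz
              exact ⟨e1, e2, e3, e4.trans (mul_le_mul_of_nonneg_right hσ2 (by linarith))⟩
            · simp only [h, if_false] at hz
              obtain ⟨e1, e2, e3, e4⟩ := hF2.mem i (by omega) h2 z hz
              exact ⟨e1, e2, lt_of_le_of_lt (mul_le_mul_of_nonneg_right hσ1 (by linarith)) e3, e4⟩
          · intro i j h1 hij h2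
            by_cases hj : j < n₁
            · have hi : i < n₁ := by omega
              simp only [hi, hj, if_true]
              exact hF.apart i j h1 hij hj
            · by_cases hi : i < n₁
              · simp only [hi, hj, if_true, if_false]
                refine apart_of_slope σ₁ (gridPoint_mem_slab (by exact_mod_cast ha1 i (by omega)))
                  (gridPoint_mem_slab (by exact_mod_cast ha1 j h2)) ?_ ?_
                · intro z hz
                  obtain ⟨e1, e2, e3, e4⟩ := hF.mem i h1 hi z hz
                  exact ⟨by linarith, e4⟩
                · intro z hz
                  obtain ⟨e1, e2, e3, e4⟩ := hF2.mem j (by omega) h2 z hz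
                  exact ⟨by linarith, e3⟩
              · simp only [hi, hj, if_false]
                exact hF2.apart i j (by omega) hij h2

end ParentTree

/-! ### Stars: a vertex with fan, stack and bottom subtree -/

namespace ParentTree

/-- A set of slabs of prescribed sizes, visible from the origin and lying in the rows `1, …, H`. -/
theorem exists_star {ι : Type*} (Q : ℕ) (hQ : 1 ≤ Q) (S : Finset ι) (f : ι → ℕ)
    (hf1 : ∀ c ∈ S, 1 ≤ f c) (hfQ : ∀ c ∈ S, f c ≤ Q) :
    ∃ (H : ℕ) (P : ι → ℤ × ℤ) (k : ι → ℤ), Q * H ≤ 16 * ∑ c ∈ S, f c + 77 * Q ^ 2 ∧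
      (∀ c ∈ S, 0 ≤ k c) ∧
      (∀ c ∈ S, ∀ p ∈ slab (P c) (k c) (f c), 2 ≤ p.1 ∧ p.1 ≤ 16 * Q ^ 2 ∧ 0 < p.2 ∧ p.2 ≤ H) ∧
      ∀ c ∈ S, ∀ c' ∈ S, c ≠ c' →
        Apart (0, 0) (P c) (P c') (slab (P c) (k c) (f c)) (slab (P c') (k c') (f c')) := by
  classical
  set N := S.card with hN
  let e : S ≃ Fin N := S.equivFin
  -- The order dual makes the sorted sizes decreasing, as the charging in `exists_fan` requires.
  let g : Fin N → ℕᵒᵈ := fun i => OrderDual.toDual (f (e.symm i))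
  let E : S ≃ Fin N := e.trans (Tuple.sort g).symm
  have hmono := Tuple.monotone_sort g
  let a : ℕ → ℕ := fun i => if h : i < N then f (E.symm ⟨i, h⟩) else 0
  have ha_of : ∀ i (h : i < N), a i = f (E.symm ⟨i, h⟩) := fun i h => dif_pos h
  have ha_not : ∀ i, ¬ i < N → a i = 0 := fun i h => dif_neg h
  have hanti : Antitone a := by
    intro i j hij
    by_cases hj : j < N
    · rw [ha_of j hj, ha_of i (lt_of_le_of_lt hij hj)]
      exact hmono (show (⟨i, lt_of_le_of_lt hij hj⟩ : Fin N) ≤ ⟨j, hj⟩ from hij)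
    · rw [ha_not j hj]; exact Nat.zero_le _
  have haQ : ∀ i, a i ≤ Q := fun i => by
    by_cases h : i < N
    · rw [ha_of i h]; exact hfQ _ (E.symm ⟨i, h⟩).2
    · rw [ha_not i h]; exact Nat.zero_le _
  have ha1 : ∀ i < N, 1 ≤ a i := fun i h => by
    rw [ha_of i h]; exact hf1 _ (E.symm ⟨i, h⟩).2
  obtain ⟨σ, P, k, hσ0, hσ, hF⟩ := exists_fan Q hQ a hanti haQ N ha1 0 (Nat.zero_le _) 0 le_rfl
  have hsum : ∑ i ∈ Ico 0 N, a i = ∑ c ∈ S, f c := by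
    rw [Nat.Ico_zero_eq_range, ← Fin.sum_univ_eq_sum_range, ← sum_coe_sort S f]
    refine Fintype.sum_equiv E.symm _ _ fun i => ?_
    rw [ha_of i i.2]
  let idx : ι → ℕ := fun c => if h : c ∈ S then E ⟨c, h⟩ else 0
  have hidx : ∀ c (h : c ∈ S), idx c = E ⟨c, h⟩ := fun c h => dif_pos h
  have hidxN : ∀ c ∈ S, idx c < N := fun c h => by rw [hidx c h]; exact (E ⟨c, h⟩).2
  have hafc : ∀ c ∈ S, a (idx c) = f c := fun c h => by
    rw [ha_of _ (hidxN c h)]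
    have : (⟨idx c, hidxN c h⟩ : Fin N) = E ⟨c, h⟩ := Fin.ext (hidx c h)
    rw [this, E.symm_apply_apply]
  have hinj : ∀ c ∈ S, ∀ c' ∈ S, idx c = idx c' → c = c' := fun c h c' h' hh => by
    rw [hidx c h, hidx c' h'] at hh
    have := E.injective (Fin.ext hh)
    exact congrArg Subtype.val this
  have hQR : (1 : ℝ) ≤ Q := by exact_mod_cast hQ
  -- The height reached by slope `σ` at the right border: `σ ≤ s / Q ^ 3 + 19 / (4 * Q)` gives `76 *
  -- Q ^ 2`, and rounding up gives 77.
  refine ⟨⌈σ * (16 * Q ^ 2)⌉₊, fun c => P (idx c), fun c => k (idx c), ?_, ?_, ?_, ?_⟩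
  · have h1 : ((⌈σ * (16 * Q ^ 2)⌉₊ : ℕ) : ℝ) ≤ σ * (16 * Q ^ 2) + 1 :=
      (Nat.ceil_lt_add_one (by positivity)).le
    have ha0 : (a 0 : ℝ) ≤ Q := by exact_mod_cast haQ 0
    rw [hsum] at hσ
    set s := ∑ c ∈ S, f c
    have h2 : σ ≤ s / Q ^ 3 + 3 / (4 * Q) + 4 / Q := by
      have : (3 * a 0 / (4 * Q ^ 2) : ℝ) ≤ 3 / (4 * Q) := by
        rw [div_le_div_iff₀ (by positivity) (by positivity)]
        nlinarith
      linarith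
    have h3 : (Q : ℝ) * (σ * (16 * Q ^ 2)) ≤ 16 * s + 76 * Q ^ 2 := by
      have : (s / Q ^ 3 + 3 / (4 * Q) + 4 / Q : ℝ) * (16 * Q ^ 3) = 16 * s + 76 * Q ^ 2 := by
        field_simp; ring
      have := mul_le_mul_of_nonneg_right h2 (by positivity : (0 : ℝ) ≤ 16 * Q ^ 3)
      linarith
    have h4 : (Q : ℝ) * (⌈σ * (16 * Q ^ 2)⌉₊ : ℕ) ≤ 16 * s + 77 * Q ^ 2 := by nlinarith
    exact_mod_cast h4
  · exact fun c hc => hF.shear _ (Nat.zero_le _) (hidxN c hc)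
  · intro c hc p hp
    have := hF.mem _ (Nat.zero_le _) (hidxN c hc) p (by rw [hafc c hc]; exact hp)
    obtain ⟨h1, h2, h3, h4⟩ := this
    have h5 : σ * p.1 ≤ σ * (16 * Q ^ 2) := mul_le_mul_of_nonneg_left h2 hσ0
    exact ⟨by nlinarith, h2, by linarith, by linarith [Nat.le_ceil (σ * (16 * (Q : ℝ) ^ 2))]⟩
  · intro c hc c' hc' hcc
    have h1 : idx c ≠ idx c' := fun h => hcc (hinj c hc c' hc' h)
    rcases lt_or_gt_of_ne h1 with h | h
    · have := hF.apart _ _ (Nat.zero_le _) h (hidxN c' hc')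
      rwa [hafc c hc, hafc c' hc'] at this
    · have := hF.apart _ _ (Nat.zero_le _) h (hidxN c hc)
      rw [hafc c hc, hafc c' hc'] at this
      exact this.symm

/-- The second coordinate, which is directed downwards, increases. -/
def Upward (p q : ℤ × ℤ) : Prop := p.2 ≤ q.2

variable {V : Type u} [Fintype V] {T : ParentTree V} {v : V}

theorem CanDraw.upward {O : ℤ × ℤ} {R : Set (ℝ × ℝ)} (h : T.CanDraw Increasing v O R) :
    T.CanDraw Upward v O R := by
  obtain ⟨pos, h0, hd⟩ := h
  exact ⟨pos, h0, hd.inj, hd.pt_mem, hd.seg_sub, hd.cross, fun x hx hxv => (hd.rel x hx hxv).2⟩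

theorem CanDraw.translate {O : ℤ × ℤ} {x y w h : ℤ} (hd : T.CanDraw Upward v O (box x y w h))
    (a b : ℤ) : T.CanDraw Upward v (a + O.1, b + O.2) (box (a + x) (b + y) w h) := by
  have := hd.map (ρ' := Upward) (R' := box (a + x) (b + y) w h) a b 1 0 (Or.inl rfl) ?_ ?_
  · simpa using this
  · intro p q h1
    simp only [Upward] at *
    linarith
  · rintro p ⟨h1, h2, h3, h4⟩
    refine ⟨?_, ?_, ?_, ?_⟩ <;> push_cast <;> linarith

theorem CanDraw.mirror {w h : ℤ} (hd : T.CanDraw Upward v (0, 0) (box 0 0 w h)) (b : ℤ) :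
    T.CanDraw Upward v (w - 1, b) (box 0 b w h) := by
  have := hd.map (ρ' := Upward) (R' := box 0 b w h) (w - 1) b (-1) 0 (Or.inr rfl) ?_ ?_
  · simpa using this
  · intro p q h1
    simp only [Upward] at *
    linarith
  · rintro p ⟨h1, h2, h3, h4⟩
    push_cast at *
    refine ⟨?_, ?_, ?_, ?_⟩ <;> push_cast <;> linarith

/-- Adding `k` times the abscissa preserves downward edges because the abscissa does not decrease
along them; this is why `Increasing` is carried along. -/
theorem CanDraw.shear {a h k : ℤ} (hd : T.CanDraw Increasing v (0, 0) (box 0 0 a h)) (hk : 0 ≤ k)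
    (hh : h ≤ a) (P : ℤ × ℤ) : T.CanDraw Upward v P (slab P k a) := by
  have := hd.map (ρ' := Upward) (R' := slab P k a) P.1 P.2 1 k (Or.inl rfl) ?_ ?_
  · simpa using this
  · rintro p q ⟨h1, h2⟩
    simp only [Upward]
    have := mul_le_mul_of_nonneg_left h1 hk
    linarith
  · rintro p ⟨h1, h2, h3, h4⟩
    have hh : (h : ℝ) ≤ a := by exact_mod_cast hh
    push_cast at *
    refine ⟨?_, ?_, ?_, ?_⟩ <;> push_cast <;> linarith

theorem CanDraw.one_le_height {ρ : ℤ × ℤ → ℤ × ℤ → Prop} {w h : ℤ}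
    (hd : T.CanDraw ρ v (0, 0) (box 0 0 w h)) : 1 ≤ h := by
  obtain ⟨pos, h0, hd⟩ := hd
  obtain ⟨-, -, -, h4⟩ := hd.pt_mem v (self_mem_sub v)
  rw [h0] at h4
  simp [gridPoint] at h4
  exact_mod_cast h4

theorem log_add_one_le {n : ℕ} (hn : 1 ≤ n) : Nat.log 2 n + 1 ≤ n :=
  Nat.log_lt_self 2 (by omega)

open Classical in
/-- Draw `v` in a corner, the subtrees of the children in `S₁` in a fan, those of the children in `S₂`
below each other, and the subtree of at most one remaining child at the bottom. -/
theorem CanDraw.star {Q w : ℕ} (hQ : 1 ≤ Q) (hw : 16 * Q ^ 2 + 1 ≤ w) (S₁ S₂ : Finset V)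
    (ht : V → ℕ) (hv : ℕ)
    (h1 : ∀ c ∈ S₁, T.sz c ≤ Q)
    (h2 : ∀ c ∈ S₂, T.CanDraw Upward c (0, 0) (box 0 0 (w - 1) (ht c)))
    (h3 : ∀ c ∈ T.ch v, c ∉ S₁ → c ∉ S₂ → T.CanDraw Upward c (0, 0) (box 0 0 w hv))
    (h3' : ∀ c ∈ T.ch v, ∀ c' ∈ T.ch v, c ∉ S₁ → c ∉ S₂ → c' ∉ S₁ → c' ∉ S₂ → c = c') :
    ∃ H : ℕ, Q * H ≤ 16 * ∑ c ∈ S₁, T.sz c + 78 * Q ^ 2 + Q * (∑ c ∈ S₂, ht c + hv) ∧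
      T.CanDraw Upward v (0, 0) (box 0 0 w H) := by
  obtain ⟨Hs, Ps, k, hHs, hk, hmem, hap⟩ := exists_star Q hQ S₁ T.sz (fun c _ => sz_pos c) h1
  obtain ⟨o, ho, hoo⟩ := exists_offsets S₂ ht
  set A := ∑ c ∈ S₂, ht c with hA
  -- The row of `v` itself costs `Q ≤ Q ^ 2`, turning 77 into 78.
  refine ⟨Hs + 1 + A + hv, ?_, ?_⟩
  · have : Q ≤ Q ^ 2 := Nat.le_self_pow (by norm_num) Q
    nlinarith
  -- Column 0 is left to the vertical edge to the bottom subtree. Edges to the stack stay in the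
  -- columns from 0 to 1, and the fan begins at column 2.
  let P : V → ℤ × ℤ := fun c => if c ∈ S₁ then Ps c else if c ∈ S₂ then (1, Hs + 1 + o c) else
    (0, Hs + 1 + A)
  let Rc : V → Set (ℝ × ℝ) := fun c => if c ∈ S₁ then slab (Ps c) (k c) (T.sz c) else
    if c ∈ S₂ then box 1 (Hs + 1 + o c) (w - 1) (ht c) else box 0 (Hs + 1 + A) w hv
  have P1 : ∀ c, c ∈ S₁ → P c = Ps c := fun c h => if_pos h
  have R1 : ∀ c, c ∈ S₁ → Rc c = slab (Ps c) (k c) (T.sz c) := fun c h => if_pos h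
  have P2 : ∀ c, c ∉ S₁ → c ∈ S₂ → P c = ((1, Hs + 1 + o c) : ℤ × ℤ) := fun c h h' => by
    simp only [P, h, h', if_true, if_false]
  have R2 : ∀ c, c ∉ S₁ → c ∈ S₂ → Rc c = box 1 (Hs + 1 + o c) (w - 1) (ht c) := fun c h h' => by
    simp only [Rc, h, h', if_true, if_false]
  have P3 : ∀ c, c ∉ S₁ → c ∉ S₂ → P c = ((0, Hs + 1 + A) : ℤ × ℤ) := fun c h h' => by
    simp only [P, h, h', if_false]
  have R3 : ∀ c, c ∉ S₁ → c ∉ S₂ → Rc c = box 0 (Hs + 1 + A) w hv := fun c h h' => by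
    simp only [Rc, h, h', if_false]
  have hPs : ∀ c ∈ S₁, (2 : ℝ) ≤ (Ps c).1 ∧ ((Ps c).1 : ℝ) ≤ 16 * Q ^ 2 ∧ (0 : ℝ) < (Ps c).2 ∧
      ((Ps c).2 : ℝ) ≤ Hs := fun c hc =>
    hmem c hc (gridPoint (Ps c)) (gridPoint_mem_slab (by exact_mod_cast sz_pos c))
  have hoR : ∀ c ∈ S₂, (o c + ht c : ℝ) ≤ A := fun c hc => by exact_mod_cast ho c hc
  have ho0 : ∀ c, (0 : ℝ) ≤ o c := fun c => by positivity
  have hHs0 : (0 : ℝ) ≤ Hs := by positivity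
  have hA0 : (0 : ℝ) ≤ A := by positivity
  have hwR : (16 * Q ^ 2 + 1 : ℝ) ≤ w := by exact_mod_cast hw
  have hQ2 : (0 : ℝ) ≤ Q ^ 2 := by positivity
  have hht : ∀ c ∈ S₂, (1 : ℝ) ≤ ht c := fun c hc => by
    have := (h2 c hc).one_le_height
    exact_mod_cast this
  have zero_eq : ∀ {p : ℝ × ℝ}, p.1 = 0 → p.2 = 0 → p = gridPoint (0, 0) := by
    intro p e1 e2
    ext
    · rw [e1]; simp [gridPoint]
    · rw [e2]; simp [gridPoint]
  -- edges to stacked and to bottom subtrees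
  have seg2 : ∀ c, ∀ p ∈ gridSeg (0, 0) (1, Hs + 1 + o c),
      0 ≤ p.1 ∧ p.1 ≤ 1 ∧ p.2 = p.1 * (Hs + 1 + o c) := by
    intro c p hp
    obtain ⟨t, h0, h1, e1, e2⟩ := mem_gridSeg_zero.1 hp
    push_cast at e1 e2
    rw [mul_one] at e1
    exact ⟨by linarith, by linarith, by rw [e1, e2]⟩
  have seg3 : ∀ p ∈ gridSeg (0, 0) (0, Hs + 1 + A), p.1 = 0 ∧ 0 ≤ p.2 ∧ p.2 ≤ Hs + 1 + A := by
    intro p hp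
    obtain ⟨t, h0, h1, e1, e2⟩ := mem_gridSeg_zero.1 hp
    push_cast at e1 e2
    exact ⟨by simpa using e1, by rw [e2]; positivity, by rw [e2]; nlinarith⟩
  have seg1 : ∀ c ∈ S₁, ∀ p ∈ gridSeg (0, 0) (Ps c), 0 ≤ p.1 ∧ p.1 ≤ 16 * Q ^ 2 ∧ 0 ≤ p.2 ∧
      p.2 ≤ Hs ∧ (p.1 = 0 → p = gridPoint (0, 0)) ∧
      (∀ b : ℝ, Hs + 1 ≤ b → p.2 = p.1 * b → p = gridPoint (0, 0)) := by
    intro c hc p hp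
    obtain ⟨t, h0, h1, e1, e2⟩ := mem_gridSeg_zero.1 hp
    obtain ⟨a1, a2, a3, a4⟩ := hPs c hc
    refine ⟨by rw [e1]; positivity, by rw [e1]; nlinarith, by rw [e2]; positivity,
      by rw [e2]; nlinarith, ?_, ?_⟩
    · intro h
      rw [h] at e1
      have : t = 0 := by
        rcases mul_eq_zero.1 e1.symm with h | h
        · exact h
        · linarith
      exact zero_eq h (by rw [e2, this]; simp)
    -- Fan corners have abscissa at least 2, so their edges have slope at most `Hs / 2`, less than
    -- that of any edge to the stack.
    · intro b hb h
      rw [e1, e2, mul_assoc] at h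
      rcases h0.eq_or_lt with h' | h'
      · exact zero_eq (by rw [e1, ← h']; simp) (by rw [e2, ← h']; simp)
      · have := mul_left_cancel₀ h'.ne' h
        nlinarith
  have ap12 : ∀ c ∈ S₁, ∀ c' ∈ S₂,
      Apart (0, 0) (Ps c) (1, Hs + 1 + o c') (slab (Ps c) (k c) (T.sz c))
        (box 1 (Hs + 1 + o c') (w - 1) (ht c')) := by
    intro c hc c' hc'
    have := ho0 c'
    refine ⟨?_, ?_, ?_, ?_⟩
    · rintro p hp ⟨a1, a2, a3, a4⟩
      have := hmem c hc p hp
      push_cast at a3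
      linarith
    · rintro p hp ⟨a1, a2, a3, a4⟩
      have := seg1 c hc p hp
      push_cast at a3
      linarith
    · intro p hp hp'
      have := hmem c hc p hp'
      have := seg2 c' p hp
      linarith
    · intro p hp hp'
      exact (seg1 c hc p hp).2.2.2.2.2 _ (by linarith) (seg2 c' p hp').2.2
  have ap13 : ∀ c ∈ S₁, Apart (0, 0) (Ps c) (0, Hs + 1 + A) (slab (Ps c) (k c) (T.sz c))
        (box 0 (Hs + 1 + A) w hv) := by
    intro c hc
    refine ⟨?_, ?_, ?_, ?_⟩
    · rintro p hp ⟨a1, a2, a3, a4⟩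
      have := hmem c hc p hp
      push_cast at a3
      linarith
    · rintro p hp ⟨a1, a2, a3, a4⟩
      have := seg1 c hc p hp
      push_cast at a3
      linarith
    · intro p hp hp'
      have := hmem c hc p hp'
      have := seg3 p hp
      linarith
    · intro p hp hp'
      exact (seg1 c hc p hp).2.2.2.2.1 (seg3 p hp').1
  have ap23 : ∀ c ∈ S₂, Apart (0, 0) (1, Hs + 1 + o c) (0, Hs + 1 + A)
      (box 1 (Hs + 1 + o c) (w - 1) (ht c)) (box 0 (Hs + 1 + A) w hv) := by
    intro c hc
    have b1 := hoR c hc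
    have b2 := hht c hc
    have b3 := ho0 c
    refine ⟨?_, ?_, ?_, ?_⟩
    · rintro p ⟨c1, c2, c3, c4⟩ ⟨a1, a2, a3, a4⟩
      push_cast at *
      linarith
    · rintro p hp ⟨a1, a2, a3, a4⟩
      obtain ⟨e0, e1, e2⟩ := seg2 c p hp
      push_cast at *
      nlinarith
    · rintro p hp ⟨a1, a2, a3, a4⟩
      have := seg3 p hp
      push_cast at *
      linarith
    · intro p hp hp'
      have e1 := (seg3 p hp').1
      exact zero_eq e1 (by rw [(seg2 c p hp).2.2, e1]; simp)
  have ap22 : ∀ c ∈ S₂, ∀ c' ∈ S₂, c ≠ c' → Apart (0, 0) (1, Hs + 1 + o c) (1, Hs + 1 + o c')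
      (box 1 (Hs + 1 + o c) (w - 1) (ht c)) (box 1 (Hs + 1 + o c') (w - 1) (ht c')) := by
    intro c hc c' hc' hcc
    have b : (o c + ht c : ℝ) ≤ o c' ∨ (o c' + ht c' : ℝ) ≤ o c := by
      exact_mod_cast hoo c hc c' hc' hcc
    have b2 := hht c hc
    have b2' := hht c' hc'
    refine ⟨?_, ?_, ?_, ?_⟩
    · rintro p ⟨c1, c2, c3, c4⟩ ⟨a1, a2, a3, a4⟩
      push_cast at *
      rcases b with b | b <;> linarith
    · rintro p hp ⟨a1, a2, a3, a4⟩
      obtain ⟨e0, e1, e2⟩ := seg2 c p hp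
      push_cast at *
      have : p.1 = 1 := le_antisymm e1 a1
      rw [this] at e2
      rcases b with b | b <;> linarith
    · rintro p hp ⟨a1, a2, a3, a4⟩
      obtain ⟨e0, e1, e2⟩ := seg2 c' p hp
      push_cast at *
      have : p.1 = 1 := le_antisymm e1 a1
      rw [this] at e2
      rcases b with b | b <;> linarith
    · intro p hp hp'
      obtain ⟨e0, e1, e2⟩ := seg2 c p hp
      obtain ⟨e0', e1', e2'⟩ := seg2 c' p hp'
      have h : p.1 * (o c - o c' : ℝ) = 0 := by linarith
      have h' : p.1 = 0 := by
        rcases mul_eq_zero.1 h with h | h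
        · exact h
        · rcases b with b | b <;> linarith
      exact zero_eq h' (by rw [e2, h']; simp)
  refine CanDraw.merge (P := P) (Rc := Rc) ?_ ?_ ?_ ?_ ?_ ?_ ?_ ?_
  · intro c hc
    by_cases c1 : c ∈ S₁
    · rw [P1 c c1, R1 c c1]
      exact (canDraw_log c).shear (hk c c1) (by exact_mod_cast log_add_one_le (sz_pos c)) _
    · by_cases c2 : c ∈ S₂
      · rw [P2 c c1 c2, R2 c c1 c2]
        simpa using (h2 c c2).translate 1 (Hs + 1 + o c)
      · rw [P3 c c1 c2, R3 c c1 c2]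
        simpa using (h3 c hc c1 c2).translate 0 (Hs + 1 + A)
  · intro c hc hO
    by_cases c1 : c ∈ S₁
    · rw [R1 c c1] at hO
      have := (hmem c c1 _ hO).1
      simp [gridPoint] at this
      linarith
    · by_cases c2 : c ∈ S₂
      · rw [R2 c c1 c2] at hO
        have := hO.1
        simp [gridPoint] at this
        linarith
      · rw [R3 c c1 c2] at hO
        have := hO.2.2.1
        simp [gridPoint] at this
        linarith
  · intro c hc p hp hp'
    by_cases c1 : c ∈ S₁
    · rw [P1 c c1] at *
      rw [R1 c c1] at hp'
      refine eq_of_mem_gridSeg_zero ?_ (fun z hz => hz.1) p hp hp'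
      have := (hPs c c1).1
      have : (0 : ℝ) < (Ps c).1 := by linarith
      exact_mod_cast this
    · by_cases c2 : c ∈ S₂
      · rw [P2 c c1 c2] at *
        rw [R2 c c1 c2] at hp'
        exact eq_of_mem_gridSeg_zero (by simp) (fun z hz => hz.1) p hp hp'
      · rw [P3 c c1 c2] at *
        rw [R3 c c1 c2] at hp'
        have e := seg3 p hp
        have := hp'.2.2.1
        push_cast at this
        ext
        · rw [e.1]; simp [gridPoint]
        · simp only [gridPoint]; push_cast; linarith
  · intro c hc c' hc' hcc
    by_cases c1 : c ∈ S₁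
    · rw [P1 c c1, R1 c c1]
      by_cases c1' : c' ∈ S₁
      · rw [P1 c' c1', R1 c' c1']; exact hap c c1 c' c1' hcc
      · by_cases c2' : c' ∈ S₂
        · rw [P2 c' c1' c2', R2 c' c1' c2']; exact ap12 c c1 c' c2'
        · rw [P3 c' c1' c2', R3 c' c1' c2']; exact ap13 c c1
    · by_cases c2 : c ∈ S₂
      · rw [P2 c c1 c2, R2 c c1 c2]
        by_cases c1' : c' ∈ S₁
        · rw [P1 c' c1', R1 c' c1']; exact (ap12 c' c1' c c2).symm
        · by_cases c2' : c' ∈ S₂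
          · rw [P2 c' c1' c2', R2 c' c1' c2']; exact ap22 c c2 c' c2' hcc
          · rw [P3 c' c1' c2', R3 c' c1' c2']; exact ap23 c c2
      · rw [P3 c c1 c2, R3 c c1 c2]
        by_cases c1' : c' ∈ S₁
        · rw [P1 c' c1', R1 c' c1']; exact (ap13 c' c1').symm
        · by_cases c2' : c' ∈ S₂
          · rw [P2 c' c1' c2', R2 c' c1' c2']; exact (ap23 c' c2').symm
          · exact absurd (h3' c hc c' hc' c1 c2 c1' c2') hcc
  · intro c hc
    by_cases c1 : c ∈ S₁
    · rw [P1 c c1]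
      have := (hPs c c1).2.2.1
      have : 0 < (Ps c).2 := by exact_mod_cast this
      exact this.le
    · by_cases c2 : c ∈ S₂
      · rw [P2 c c1 c2]; simp only [Upward]; positivity
      · rw [P3 c c1 c2]; simp only [Upward]; positivity
  · have hv0 : (0 : ℝ) ≤ hv := by positivity
    refine ⟨?_, ?_, ?_, ?_⟩ <;> simp [gridPoint]
    · exact le_trans (Nat.le_add_left 1 _) hw
    · linarith
  · intro c hc p hp
    have hv0 : (0 : ℝ) ≤ hv := by positivity
    by_cases c1 : c ∈ S₁
    · rw [P1 c c1] at hp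
      obtain ⟨e1, e2, e3, e4, -⟩ := seg1 c c1 p hp
      refine ⟨?_, ?_, ?_, ?_⟩ <;> push_cast <;> linarith
    · by_cases c2 : c ∈ S₂
      · rw [P2 c c1 c2] at hp
        obtain ⟨e1, e2, e3⟩ := seg2 c p hp
        have b1 := hoR c c2
        have b2 := hht c c2
        have b3 := ho0 c
        have b4 : p.1 * (Hs + 1 + o c : ℝ) ≤ 1 * (Hs + 1 + o c) :=
          mul_le_mul_of_nonneg_right e2 (by linarith)
        have hQ1 : (1 : ℝ) ≤ Q ^ 2 := one_le_pow₀ (by exact_mod_cast hQ)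
        refine ⟨?_, ?_, ?_, ?_⟩ <;> push_cast
        · linarith
        · linarith
        · rw [e3]; positivity
        · linarith
      · rw [P3 c c1 c2] at hp
        obtain ⟨e1, e2, e3⟩ := seg3 p hp
        have := (h3 c hc c1 c2).one_le_height
        have : (1 : ℝ) ≤ hv := by exact_mod_cast this
        refine ⟨?_, ?_, ?_, ?_⟩ <;> push_cast <;> linarith
  · intro c hc
    by_cases c1 : c ∈ S₁
    · rw [R1 c c1]
      intro p hp
      have hv0 : (0 : ℝ) ≤ hv := by positivity
      obtain ⟨e1, e2, e3, e4⟩ := hmem c c1 p hp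
      refine ⟨?_, ?_, ?_, ?_⟩ <;> push_cast <;> linarith
    · by_cases c2 : c ∈ S₂
      · rw [R2 c c1 c2]
        have := ho c c2
        exact box_subset (by omega) (by omega) (by omega) (by push_cast; omega)
      · rw [R3 c c1 c2]
        exact box_subset (by omega) (by omega) (by omega) (by push_cast; omega)

end ParentTree

/-! ### The recursion for large subtrees -/

namespace ParentTree

variable {V : Type u} [Fintype V] {T : ParentTree V}

/-- A crude bound, enough for `Q` times the height of a shelf to be `O(Q ^ 2)`. -/
theorem log_four_mul_sq_lt (Q : ℕ) (hQ : 1 ≤ Q) : Nat.log 2 (4 * Q ^ 2) < 2 * Q + 2 := by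
  refine Nat.log_lt_of_lt_pow (by positivity) ?_
  have h : Q < 2 ^ Q := Nat.lt_two_pow_self
  calc 4 * Q ^ 2 < 4 * (2 ^ Q) ^ 2 := by
        have := Nat.pow_lt_pow_left h (n := 2) (by norm_num)
        omega
    _ = 2 ^ (2 * Q + 2) := by ring

theorem CanDraw.of_sz_le {c : V} {B : ℕ} (hc : T.sz c ≤ B) {w : ℤ} (hw : B ≤ w) :
    T.CanDraw Upward c (0, 0) (box 0 0 w (Nat.log 2 B + 1 : ℕ)) := by
  have : Nat.log 2 (T.sz c) ≤ Nat.log 2 B := Nat.log_mono_right hc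
  exact (canDraw_log c).upward.mono (box_subset le_rfl (by omega) le_rfl (by push_cast; omega))

open Classical in
-- The children in `S` are split at size `Q`: the small ones go to the fan, where a vertex costs `16
-- / Q` rows, the others to the stack. `b c` is the cost allotted to `c`, in units of `1 / Q` row.
theorem exists_star_drawing {v : V} {Q w : ℕ} (hQ : 1 ≤ Q) (hw : 16 * Q ^ 2 + 1 ≤ w) (S : Finset V)
    (ht b : V → ℕ) (hv : ℕ)
    (hS : ∀ c ∈ S, T.CanDraw Upward c (0, 0) (box 0 0 (w - 1) (ht c)))
    (hb1 : ∀ c ∈ S, T.sz c ≤ Q → 16 * T.sz c ≤ b c)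
    (hb2 : ∀ c ∈ S, Q < T.sz c → Q * ht c ≤ b c)
    (h3 : ∀ c ∈ T.ch v, c ∉ S → T.CanDraw Upward c (0, 0) (box 0 0 w hv))
    (h3' : ∀ c ∈ T.ch v, ∀ c' ∈ T.ch v, c ∉ S → c' ∉ S → c = c') :
    ∃ H : ℕ, Q * H ≤ ∑ c ∈ S, b c + 78 * Q ^ 2 + Q * hv ∧
      T.CanDraw Upward v (0, 0) (box 0 0 w H) := by
  have hnot : ∀ c, c ∉ S.filter (T.sz · ≤ Q) → c ∉ S.filter (¬ T.sz · ≤ Q) → c ∉ S := by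
    intro c h1 h2 h
    rw [mem_filter] at h1 h2
    tauto
  obtain ⟨H, hH, hd⟩ := CanDraw.star (v := v) hQ hw (S.filter (T.sz · ≤ Q))
    (S.filter (¬ T.sz · ≤ Q)) ht hv (fun c hc => (mem_filter.1 hc).2)
    (fun c hc => hS c (mem_filter.1 hc).1) (fun c hc h1 h2 => h3 c hc (hnot c h1 h2))
    (fun c hc c' hc' h1 h2 h1' h2' => h3' c hc c' hc' (hnot c h1 h2) (hnot c' h1' h2'))
  refine ⟨H, hH.trans ?_, hd⟩
  rw [mul_add, mul_sum, mul_sum]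
  have e1 : ∑ c ∈ S.filter (T.sz · ≤ Q), 16 * T.sz c ≤ ∑ c ∈ S.filter (T.sz · ≤ Q), b c :=
    sum_le_sum fun c hc => hb1 c (mem_filter.1 hc).1 (mem_filter.1 hc).2
  have e2 : ∑ c ∈ S.filter (¬ T.sz · ≤ Q), Q * ht c ≤ ∑ c ∈ S.filter (¬ T.sz · ≤ Q), b c :=
    sum_le_sum fun c hc => hb2 c (mem_filter.1 hc).1 (not_le.1 (mem_filter.1 hc).2)
  have e3 := sum_filter_add_sum_filter_not S (T.sz · ≤ Q) b
  omega

/-- All but at most `B` vertices of the subtree of `v` belong to the subtree of its child `u`, which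
has more than `B` vertices. -/
def Thin (T : ParentTree V) (B : ℕ) (v u : V) : Prop :=
  u ∈ T.ch v ∧ B < T.sz u ∧ T.sz v ≤ T.sz u + B

/-- A box without the part of its rows `0, …, h` left of the column `x`, and of row `0` left of the
column `x'`. -/
def notchedBox (w H h x x' : ℤ) : Set (ℝ × ℝ) :=
  {z | z ∈ box 0 0 w H ∧ (z.2 < h + 1 → (x : ℝ) ≤ z.1) ∧ (z.2 = 0 → (x' : ℝ) ≤ z.1)}

/-- Prefix a vertex, with the small subtrees of its other children on a shelf, to the drawing of a
chain. -/
theorem CanDraw.shelf_cons {v u : V} {w H h x x' s : ℕ} (hu : u ∈ T.ch v)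
    (hs : T.sz v = 1 + T.sz u + s) (hh : 1 ≤ h) (hhH : h + 1 ≤ H) (hx' : x + 1 + s ≤ x')
    (hxw : x' + 1 ≤ w)
    (hlight : ∀ c ∈ T.ch v, c ≠ u → ∀ o : ℤ, T.CanDraw Upward c (o, 1) (box o 1 (T.sz c) h))
    (hdu : T.CanDraw Upward u (x', 0) (notchedBox w H h (x + 1 + s) x')) :
    T.CanDraw Upward v (x, 0) (notchedBox w H h x x) := by
  have r1 : (1 : ℝ) ≤ h := by exact_mod_cast hh
  have r2 : (h + 1 : ℝ) ≤ H := by exact_mod_cast hhH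
  have r3 : (x + 1 + s : ℝ) ≤ x' := by exact_mod_cast hx'
  have r4 : (x' + 1 : ℝ) ≤ w := by exact_mod_cast hxw
  have r5 : (0 : ℝ) ≤ x := by positivity
  have r6 : (0 : ℝ) ≤ s := by positivity
  have hseg : ∀ p ∈ gridSeg ((x : ℤ), 0) ((x' : ℤ), 0), p.2 = 0 ∧ (x : ℝ) ≤ p.1 ∧ p.1 ≤ x' := by
    intro p hp
    obtain ⟨t, h0, ht1, e1, e2⟩ := mem_gridSeg.1 hp
    push_cast at *
    exact ⟨by linarith, by nlinarith, by nlinarith⟩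
  refine CanDraw.shelf (x0 := x) (x := x) (h := h) hu hs le_rfl (by exact_mod_cast hh) hlight hdu ?_
    (Or.inl rfl) ?_ ?_ ?_ ?_ ?_ ?_ ?_
  · rintro z ⟨-, h1, -⟩ h2
    have := h1 h2
    push_cast at *
    constructor <;> linarith
  · rintro p hp ⟨-, -, h2⟩
    obtain ⟨e1, e2, e3⟩ := hseg p hp
    have := h2 e1
    push_cast at *
    ext
    · simp [gridPoint]; linarith
    · simp [gridPoint]; linarith
  · intro o _; simp [Upward]
  · simp [Upward]
  · refine ⟨⟨?_, ?_, ?_, ?_⟩, ?_, ?_⟩ <;> simp [gridPoint] <;> linarith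
  · intro p hp
    obtain ⟨e1, e2, e3⟩ := hseg p hp
    refine ⟨⟨?_, ?_, ?_, ?_⟩, ?_, ?_⟩ <;> push_cast <;> intros <;> linarith
  · rintro z ⟨h1, h2, h3⟩
    refine ⟨h1, fun h => ?_, fun h => ?_⟩
    · have := h2 h
      push_cast at *
      linarith
    · have := h3 h
      push_cast at *
      linarith
  · intro z h1 h2 h3 h4
    push_cast at *
    refine ⟨⟨?_, ?_, ?_, ?_⟩, ?_, ?_⟩ <;> push_cast
    · linarith
    · rcases h4 with h4 | h4 <;> linarith
    · linarith
    · linarith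
    · intros; linarith
    · intros; linarith

/-- A vertex in the right corner with the small subtrees of its other children on a shelf, and with the
subtree of `u` below. -/
theorem CanDraw.shelf_last {v u : V} {w Hu h x s : ℕ} (hu : u ∈ T.ch v)
    (hs : T.sz v = 1 + T.sz u + s) (hh : 1 ≤ h) (hxw : x + s + 1 ≤ w)
    (hlight : ∀ c ∈ T.ch v, c ≠ u → ∀ o : ℤ, T.CanDraw Upward c (o, 1) (box o 1 (T.sz c) h))
    (hdu : T.CanDraw Upward u (0, 0) (box 0 0 w Hu)) :
    T.CanDraw Upward v (w - 1, 0) (notchedBox w (h + 1 + Hu) h x (w - 1)) := by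
  have r1 : (1 : ℝ) ≤ h := by exact_mod_cast hh
  have r2 : (x + s + 1 : ℝ) ≤ w := by exact_mod_cast hxw
  have r3 : (1 : ℝ) ≤ Hu := by
    have := hdu.one_le_height
    exact_mod_cast this
  have r5 : (0 : ℝ) ≤ x := by positivity
  have r6 : (0 : ℝ) ≤ s := by positivity
  have hseg : ∀ p ∈ gridSeg ((w : ℤ) - 1, 0) ((w : ℤ) - 1, (h : ℤ) + 1),
      p.1 = w - 1 ∧ 0 ≤ p.2 ∧ p.2 ≤ h + 1 := by
    intro p hp
    obtain ⟨t, h0, ht1, e1, e2⟩ := mem_gridSeg.1 hp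
    push_cast at *
    exact ⟨by linarith, by nlinarith, by nlinarith⟩
  refine CanDraw.shelf (x0 := w - 1) (x := x) (h := h) hu hs (by omega) (by exact_mod_cast hh) hlight
    (hdu.mirror (h + 1)) ?_ (Or.inr ⟨rfl, by omega⟩) ?_ ?_ ?_ ?_ ?_ ?_ ?_
  · rintro z ⟨-, -, h1, -⟩ h2
    push_cast at *
    linarith
  · rintro p hp ⟨-, -, h2, -⟩
    obtain ⟨e1, e2, e3⟩ := hseg p hp
    push_cast at *
    ext
    · simp [gridPoint]; linarith
    · simp [gridPoint]; linarith
  · intro o _; simp [Upward]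
  · simp only [Upward]; positivity
  · refine ⟨⟨?_, ?_, ?_, ?_⟩, ?_, ?_⟩ <;> simp [gridPoint] <;> intros
    · omega
    · linarith
    · linarith
  · intro p hp
    obtain ⟨e1, e2, e3⟩ := hseg p hp
    refine ⟨⟨?_, ?_, ?_, ?_⟩, ?_, ?_⟩ <;> push_cast <;> intros <;> linarith
  · rintro z ⟨h1, h2, h3, h4⟩
    push_cast at *
    refine ⟨⟨?_, ?_, ?_, ?_⟩, ?_, ?_⟩ <;> push_cast <;> intros <;> linarith
  · intro z h1 h2 h3 h4
    push_cast at *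
    refine ⟨⟨?_, ?_, ?_, ?_⟩, ?_, ?_⟩ <;> push_cast
    · linarith
    · rcases h4 with h4 | h4 <;> linarith
    · linarith
    · linarith
    · intros; linarith
    · intros; linarith

open Classical in
/-- Drawings of the subtree of a vertex `v` in the case that one of its children dominates. -/
theorem exists_drawing_of_thin {Q l w : ℕ} {v u : V} (hQ : 1 ≤ Q) (hl : Nat.log 2 (4 * Q ^ 2) + 16 ≤ l)
    (hw : 16 * Q ^ 2 + 1 ≤ w) (hvu : T.Thin (4 * Q ^ 2) v u)
    (hD : ∃ H : ℕ, Q * H + 200 * Q ^ 2 ≤ 200 * l * T.sz u ∧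
      ((∀ u', ¬ T.Thin (4 * Q ^ 2) u u') → Q * H + 300 * Q ^ 2 ≤ 200 * l * T.sz u) ∧
      T.CanDraw Upward u (0, 0) (box 0 0 w H))
    (hE : ∀ u', T.Thin (4 * Q ^ 2) u u' → ∀ x : ℕ, 1 ≤ x → x + T.sz u ≤ 16 * Q ^ 2 + T.sz u' →
      ∃ H x' : ℕ, Nat.log 2 (4 * Q ^ 2) + 2 ≤ H ∧ x ≤ x' ∧ x' + 1 ≤ w ∧
        Q * H + 200 * Q ^ 2 ≤ 200 * l * (T.sz u + x) ∧
        T.CanDraw Upward u (x', 0) (notchedBox w H (Nat.log 2 (4 * Q ^ 2) + 1 : ℕ) x x')) :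
    (∃ H : ℕ, Q * H + 200 * Q ^ 2 ≤ 200 * l * T.sz v ∧
      T.CanDraw Upward v (0, 0) (box 0 0 w H)) ∧
    ∀ x : ℕ, 1 ≤ x → x + T.sz v ≤ 16 * Q ^ 2 + T.sz u →
      ∃ H x' : ℕ, Nat.log 2 (4 * Q ^ 2) + 2 ≤ H ∧ x ≤ x' ∧ x' + 1 ≤ w ∧
        Q * H + 200 * Q ^ 2 ≤ 200 * l * (T.sz v + x) ∧
        T.CanDraw Upward v (x', 0) (notchedBox w H (Nat.log 2 (4 * Q ^ 2) + 1 : ℕ) x x') := by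
  obtain ⟨hu, hBu, hvB⟩ := hvu
  have hsz := sz_eq_add_erase hu
  set s := ∑ c ∈ (T.ch v).erase u, T.sz c with hs
  set B := 4 * Q ^ 2 with hB
  set L := Nat.log 2 B with hL
  have hQ2 : Q ≤ Q ^ 2 := Nat.le_self_pow (by norm_num) Q
  have hlog : L < 2 * Q + 2 := log_four_mul_sq_lt Q hQ
  have hsmall : ∀ c ∈ T.ch v, c ≠ u → T.sz c ≤ B := fun c hc hcu => by
    have : T.sz c ≤ s :=
      single_le_sum (f := T.sz) (fun _ _ => Nat.zero_le _) (mem_erase.2 ⟨hcu, hc⟩)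
    omega
  have hlight : ∀ c ∈ T.ch v, c ≠ u → ∀ o : ℤ,
      T.CanDraw Upward c (o, 1) (box o 1 (T.sz c) (L + 1 : ℕ)) := fun c hc hcu o => by
    have h1 : Nat.log 2 (T.sz c) ≤ L := Nat.log_mono_right (hsmall c hc hcu)
    have := (canDraw_log (T := T) c).upward.translate o 1
    simp only [add_zero] at this
    exact this.mono (box_subset le_rfl le_rfl le_rfl (by push_cast; omega))
  constructor
  · by_cases hth : ∃ u', T.Thin B u u'
    · obtain ⟨u', hu'⟩ := hth
      -- `v` opens a row, taking `1 + s` columns. The columns already used enter the bound for `u`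
      -- like additional vertices, so nothing is lost in passing to `v`.
      obtain ⟨H, x', h1, h2, h3, h4, h5⟩ := hE u' hu' (1 + s) (by omega) (by
        have := hu'.2.2
        omega)
      refine ⟨H, ?_, ?_⟩
      · rw [hsz, show 1 + T.sz u + s = T.sz u + (1 + s) by ring]; exact h4
      · have := CanDraw.shelf_cons (x := 0) hu hsz (by omega) (by omega) (by omega) h3 hlight
          (x' := x') (H := H) (h := L + 1) (by simpa using h5)
        simp only [Nat.cast_zero] at this
        exact this.mono fun z hz => hz.1
    · push Not at hth
      -- The larger reserve of `u`, which is not thin, has `100 * Q ^ 2` to spare for the star at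
      -- `v`.
      obtain ⟨Hu, -, hHu, hdu⟩ := hD
      have hHu := hHu hth
      obtain ⟨H, hH, hd⟩ := exists_star_drawing (v := v) hQ hw ((T.ch v).erase u) (fun _ => L + 1)
        (fun c => l * T.sz c) Hu
        (fun c hc => CanDraw.of_sz_le (hsmall c (mem_erase.1 hc).2 (mem_erase.1 hc).1) (by
          push_cast [hB]; have : (16 * Q ^ 2 + 1 : ℤ) ≤ w := by exact_mod_cast hw
          nlinarith))
        (fun c _ _ => Nat.mul_le_mul_right _ (by omega))
        (fun c _ h => by rw [mul_comm]; exact Nat.mul_le_mul (by omega) h.le)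
        (fun c hc hcS => by
          have : c = u := by by_contra h; exact hcS (mem_erase.2 ⟨h, hc⟩)
          rw [this]; exact hdu)
        (fun c hc c' hc' hcS hcS' => by
          have e1 : c = u := by by_contra h; exact hcS (mem_erase.2 ⟨h, hc⟩)
          have e2 : c' = u := by by_contra h; exact hcS' (mem_erase.2 ⟨h, hc'⟩)
          rw [e1, e2])
      refine ⟨H, ?_, hd⟩
      rw [← mul_sum, ← hs] at hH
      rw [hsz]
      nlinarith
  · intro x hx hxv
    -- Either the next vertex is thin and still has room in the row, or `v` closes the row in the
    -- right corner.
    by_cases hth : ∃ u', T.Thin B u u' ∧ x + 1 + s + T.sz u ≤ 16 * Q ^ 2 + T.sz u'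
    · obtain ⟨u', hu', hxu⟩ := hth
      obtain ⟨H, x', h1, h2, h3, h4, h5⟩ := hE u' hu' (x + 1 + s) (by omega) hxu
      refine ⟨H, x, h1, le_rfl, by omega, ?_, ?_⟩
      · rw [hsz, show 1 + T.sz u + s + x = T.sz u + (x + 1 + s) by ring]; exact h4
      · exact CanDraw.shelf_cons hu hsz (by omega) (by omega) h2 h3 hlight (by exact_mod_cast h5)
    · obtain ⟨Hu, hHu, hHu', hdu⟩ := hD
      refine ⟨L + 1 + 1 + Hu, w - 1, by omega, by omega, by omega, ?_, ?_⟩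
      · rw [hsz]
        have e1 : Q * (L + 2) ≤ 10 * Q ^ 2 := by nlinarith
        by_cases hth' : ∃ u', T.Thin B u u'
        · obtain ⟨u', hu'⟩ := hth'
          have h1 : ¬ x + 1 + s + T.sz u ≤ 16 * Q ^ 2 + T.sz u' := fun h => hth ⟨u', hu', h⟩
          have h2 := hu'.2.2
          -- The row is full: `u` would need at most `4 * Q ^ 2` of the `16 * Q ^ 2` columns. The
          -- used columns pay for the `L + 2` rows.
          have h3 : 12 * Q ^ 2 ≤ x + 1 + s := by omega
          have h4 : 1 * (12 * Q ^ 2) ≤ l * (x + 1 + s) := Nat.mul_le_mul (by omega) h3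
          nlinarith
        · push Not at hth'
          have := hHu' hth'
          have h4 : 0 ≤ l * (x + 1 + s) := Nat.zero_le _
          nlinarith
      · have := CanDraw.shelf_last (x := x) hu hsz (by omega) (by omega) hlight hdu
        rw [Nat.cast_sub (by omega)]
        exact_mod_cast this

open Classical in
/-- Drawings of the subtree of a vertex none of whose children dominates. -/
theorem exists_drawing_of_not_thin {Q l w : ℕ} {v : V} (hQ : 1 ≤ Q)
    (hl : Nat.log 2 (4 * Q ^ 2) + 16 ≤ l) (hv : 4 * Q ^ 2 < T.sz v)
    (hw : 16 * Q ^ 2 + 1 ≤ w) (hvu : ∀ u, ¬ T.Thin (4 * Q ^ 2) v u)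
    (hD : ∀ u ∈ T.ch v, 4 * Q ^ 2 < T.sz u →
      ∃ H : ℕ, Q * H + 200 * Q ^ 2 ≤ 200 * l * T.sz u ∧ T.CanDraw Upward u (0, 0) (box 0 0 w H))
    (hD' : ∀ u ∈ T.ch v, 4 * Q ^ 2 < T.sz u → 2 * T.sz u ≤ T.sz v →
      ∃ H : ℕ, Q * H + 200 * Q ^ 2 ≤ 200 * l * T.sz u ∧
        T.CanDraw Upward u (0, 0) (box 0 0 (w - 1) H)) :
    ∃ H : ℕ, Q * H + 300 * Q ^ 2 ≤ 200 * l * T.sz v ∧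
      T.CanDraw Upward v (0, 0) (box 0 0 w H) := by
  set B := 4 * Q ^ 2 with hB
  set L := Nat.log 2 B with hL
  have hBw : (B : ℤ) ≤ (w : ℤ) - 1 := by
    push_cast [hB]; have : (16 * Q ^ 2 + 1 : ℤ) ≤ w := by exact_mod_cast hw
    nlinarith
  by_cases hall : ∀ c ∈ T.ch v, T.sz c ≤ B
  · obtain ⟨H, hH, hd⟩ := exists_star_drawing (v := v) hQ hw (T.ch v) (fun _ => L + 1)
      (fun c => l * T.sz c) 0 (fun c hc => CanDraw.of_sz_le (hall c hc) hBw)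
      (fun c _ _ => Nat.mul_le_mul_right _ (by omega))
      (fun c _ h => by rw [mul_comm]; exact Nat.mul_le_mul (by omega) h.le)
      (fun c hc hcS => absurd hc hcS) (fun c hc c' hc' hcS hcS' => absurd hc hcS)
    refine ⟨H, ?_, hd⟩
    rw [← mul_sum] at hH
    have hsz := sz_eq (T := T) v
    set s := ∑ c ∈ T.ch v, T.sz c
    have h1 : 1 * B ≤ l * T.sz v := Nat.mul_le_mul (by omega) hv.le
    have h2 : l * s ≤ l * T.sz v := Nat.mul_le_mul_left _ (by omega)
    nlinarith
  · push Not at hall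
    obtain ⟨c₁, hc₁, hc₁B⟩ := hall
    obtain ⟨u, hu, hmax⟩ := exists_max_image (T.ch v) T.sz ⟨c₁, hc₁⟩
    have huB : B < T.sz u := lt_of_lt_of_le hc₁B (hmax c₁ hc₁)
    have hsz := sz_eq_add_erase hu
    set s := ∑ c ∈ (T.ch v).erase u, T.sz c with hs
    have hsB : B ≤ s := by
      by_contra h
      exact hvu u ⟨hu, huB, by omega⟩
    obtain ⟨Hu, hHu, hdu⟩ := hD u hu huB
    have hrest : ∀ c ∈ T.ch v, c ∉ (T.ch v).erase u → c = u := fun c hc hcS => by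
      by_contra h; exact hcS (mem_erase.2 ⟨h, hc⟩)
    -- With a second large child, two reserves of `200 * Q ^ 2` are available, which cover `78 * Q ^
    -- 2` for the star and the required `300 * Q ^ 2`. Otherwise the small subtrees, costing at most
    -- `l` per vertex and having at least `B` vertices in all, leave enough.
    by_cases hbig : ∃ c₀ ∈ (T.ch v).erase u, B < T.sz c₀
    · obtain ⟨c₀, hc₀, hc₀B⟩ := hbig
      have hex : ∀ c ∈ (T.ch v).erase u, ∃ Hc : ℕ,
          T.CanDraw Upward c (0, 0) (box 0 0 (w - 1) Hc) ∧
          (Q < T.sz c → Q * Hc + (if B < T.sz c then 200 * Q ^ 2 else 0) ≤ 200 * l * T.sz c) := by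
        intro c hc
        obtain ⟨hcu, hcv⟩ := mem_erase.1 hc
        by_cases hcB : B < T.sz c
        · have h1 : T.sz c ≤ T.sz u := hmax c hcv
          have h2 : T.sz c ≤ s := single_le_sum (f := T.sz) (fun _ _ => Nat.zero_le _) hc
          obtain ⟨Hc, e1, e2⟩ := hD' c hcv hcB (by omega)
          exact ⟨Hc, e2, fun _ => by rw [if_pos hcB]; exact e1⟩
        · refine ⟨L + 1, CanDraw.of_sz_le (not_lt.1 hcB) hBw, fun h => ?_⟩
          rw [if_neg hcB, add_zero, mul_comm]
          exact Nat.mul_le_mul (by omega) h.le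
      choose! ht hht1 hht2 using hex
      obtain ⟨H, hH, hd⟩ := exists_star_drawing (v := v) hQ hw ((T.ch v).erase u) ht
        (fun c => 200 * l * T.sz c - (if B < T.sz c then 200 * Q ^ 2 else 0)) Hu hht1
        (fun c hc h => by
          have hQ2 : Q ≤ Q ^ 2 := Nat.le_self_pow (by norm_num) Q
          rw [if_neg (by omega), Nat.sub_zero]
          exact Nat.mul_le_mul_right _ (by omega))
        (fun c hc h => Nat.le_sub_of_add_le (hht2 c hc h))
        (fun c hc hcS => by rw [hrest c hc hcS]; exact hdu)
        (fun c hc c' hc' hcS hcS' => by rw [hrest c hc hcS, hrest c' hc' hcS'])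
      refine ⟨H, ?_, hd⟩
      have hsum : ∑ c ∈ (T.ch v).erase u,
          (200 * l * T.sz c - (if B < T.sz c then 200 * Q ^ 2 else 0)) + 200 * Q ^ 2 ≤
          200 * l * s := by
        rw [hs, ← add_sum_erase _ _ hc₀, ← add_sum_erase _ T.sz hc₀, if_pos hc₀B, mul_add, mul_sum]
        have h1 : ∑ c ∈ ((T.ch v).erase u).erase c₀,
            (200 * l * T.sz c - (if B < T.sz c then 200 * Q ^ 2 else 0)) ≤
            ∑ c ∈ ((T.ch v).erase u).erase c₀, 200 * l * T.sz c :=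
          sum_le_sum fun c _ => Nat.sub_le _ _
        have h2 : 1 * B ≤ l * T.sz c₀ := Nat.mul_le_mul (by omega) hc₀B.le
        have h3 : 200 * Q ^ 2 ≤ 200 * l * T.sz c₀ := by nlinarith
        omega
      rw [hsz]
      nlinarith
    · push Not at hbig
      obtain ⟨H, hH, hd⟩ := exists_star_drawing (v := v) hQ hw ((T.ch v).erase u) (fun _ => L + 1)
        (fun c => l * T.sz c) Hu (fun c hc => CanDraw.of_sz_le (hbig c hc) hBw)
        (fun c _ _ => Nat.mul_le_mul_right _ (by omega))
        (fun c _ h => by rw [mul_comm]; exact Nat.mul_le_mul (by omega) h.le)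
        (fun c hc hcS => by rw [hrest c hc hcS]; exact hdu)
        (fun c hc c' hc' hcS hcS' => by rw [hrest c hc hcS, hrest c' hc' hcS'])
      refine ⟨H, ?_, hd⟩
      rw [← mul_sum, ← hs] at hH
      rw [hsz]
      have h1 : 1 * B ≤ l * s := Nat.mul_le_mul (by omega) hsB
      nlinarith

/-- Every large subtree has a drawing with `O(Q² + log n)` columns and `O(l n / Q)` rows. -/
theorem exists_drawing {Q l : ℕ} (hQ : 1 ≤ Q) (hl : Nat.log 2 (4 * Q ^ 2) + 16 ≤ l) (v : V)
    (hv : 4 * Q ^ 2 < T.sz v) (w : ℕ) (hw : 16 * Q ^ 2 + 1 + Nat.log 2 (T.sz v) ≤ w) :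
    (∃ H : ℕ, Q * H + 200 * Q ^ 2 ≤ 200 * l * T.sz v ∧
      ((∀ u, ¬ T.Thin (4 * Q ^ 2) v u) → Q * H + 300 * Q ^ 2 ≤ 200 * l * T.sz v) ∧
      T.CanDraw Upward v (0, 0) (box 0 0 w H)) ∧
    ∀ u, T.Thin (4 * Q ^ 2) v u → ∀ x : ℕ, 1 ≤ x → x + T.sz v ≤ 16 * Q ^ 2 + T.sz u →
      ∃ H x' : ℕ, Nat.log 2 (4 * Q ^ 2) + 2 ≤ H ∧ x ≤ x' ∧ x' + 1 ≤ w ∧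
        Q * H + 200 * Q ^ 2 ≤ 200 * l * (T.sz v + x) ∧
        T.CanDraw Upward v (x', 0) (notchedBox w H (Nat.log 2 (4 * Q ^ 2) + 1 : ℕ) x x') := by
  induction hn : T.sz v using Nat.strong_induction_on generalizing v w with
  | _ n ih =>
    subst hn
    have hthin : ∀ u, T.Thin (4 * Q ^ 2) v u → _ := fun u hu =>
      have hlog : Nat.log 2 (T.sz u) ≤ Nat.log 2 (T.sz v) := Nat.log_mono_right (sz_ch_lt hu.1).le
      have h := ih (T.sz u) (sz_ch_lt hu.1) u hu.2.1 w (by omega) rfl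
      exists_drawing_of_thin hQ hl (by omega) hu h.1 h.2
    refine ⟨?_, fun u hu => (hthin u hu).2⟩
    by_cases h : ∃ u, T.Thin (4 * Q ^ 2) v u
    · obtain ⟨u, hu⟩ := h
      obtain ⟨H, hH, hd⟩ := (hthin u hu).1
      exact ⟨H, hH, fun h' => absurd hu (h' u), hd⟩
    · push Not at h
      obtain ⟨H, hH, hd⟩ := exists_drawing_of_not_thin (w := w) hQ hl hv (by omega) h
        (fun u hu huB => by
          have hlog : Nat.log 2 (T.sz u) ≤ Nat.log 2 (T.sz v) := Nat.log_mono_right (sz_ch_lt hu).le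
          obtain ⟨H, hH, -, hd⟩ := (ih (T.sz u) (sz_ch_lt hu) u huB w (by omega) rfl).1
          exact ⟨H, hH, hd⟩)
        (fun u hu huB h2 => by
          have hlog : Nat.log 2 (T.sz u) + 1 ≤ Nat.log 2 (T.sz v) := by
            have h0 := sz_pos (T := T) u
            rw [← Nat.log_mul_base (by norm_num) (by omega)]
            exact Nat.log_mono_right (by omega)
          -- Halving the size lowers the required width by one, which is the column given up in the
          -- stack.
          obtain ⟨H, hH, -, hd⟩ := (ih (T.sz u) (sz_ch_lt hu) u huB (w - 1) (by omega) rfl).1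
          rw [Nat.cast_sub (by omega)] at hd
          exact ⟨H, hH, by exact_mod_cast hd⟩)
      exact ⟨H, by omega, fun _ => hH, hd⟩

end ParentTree

/-! ### Transfer to graphs and choice of parameters -/

open Classical in
-- The parent of a vertex other than `r` is its neighbour on a shortest walk to `r`. It is unique:
-- two candidates would give two paths from `r`, and paths in a tree are unique.
theorem exists_parentTree {V : Type u} {G : SimpleGraph V} (hG : G.IsTree) (r : V) :
    ∃ T : ParentTree V, T.root = r ∧
      (∀ u v, G.Adj u v → u ≠ r ∧ T.par u = v ∨ v ≠ r ∧ T.par v = u) ∧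
      (∀ v w, IsChildOf G r v w → w ≠ r ∧ T.par w = v) := by
  have hex : ∀ x, x ≠ r → ∃ y, G.Adj x y ∧ G.dist r x = G.dist r y + 1 := by
    intro x hx
    obtain ⟨p, hp⟩ := hG.connected.exists_walk_length_eq_dist x r
    cases p with
    | nil => exact absurd rfl hx
    | @cons _ y _ h p =>
      refine ⟨y, h, ?_⟩
      have h1 := SimpleGraph.dist_le p
      rw [SimpleGraph.Walk.length_cons, SimpleGraph.dist_comm] at hp
      rw [SimpleGraph.dist_comm] at h1
      rcases hG.dist_eq_dist_add_one_of_adj r h with h2 | h2 <;> omega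
  have huniq : ∀ x y y', G.Adj x y → G.Adj x y' → G.dist r x = G.dist r y + 1 →
      G.dist r x = G.dist r y' + 1 → y = y' := by
    intro x y y' h h' hd hd'
    obtain ⟨p, hp⟩ := hG.connected.exists_walk_length_eq_dist r y
    obtain ⟨p', hp'⟩ := hG.connected.exists_walk_length_eq_dist r y'
    have hq : (p.concat h.symm).IsPath :=
      SimpleGraph.Walk.isPath_of_length_eq_dist _ (by rw [SimpleGraph.Walk.length_concat, hp, hd])
    have hq' : (p'.concat h'.symm).IsPath :=
      SimpleGraph.Walk.isPath_of_length_eq_dist _ (by rw [SimpleGraph.Walk.length_concat, hp', hd'])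
    have e := (hG.existsUnique_path r x).unique hq hq'
    have := congrArg SimpleGraph.Walk.penultimate e
    simpa using this
  choose! f hf1 hf2 using hex
  let par : V → V := fun x => if x = r then r else f x
  have hpar : ∀ x, x ≠ r → par x = f x := fun x hx => if_neg hx
  have key : ∀ x y, G.Adj x y → G.dist r x = G.dist r y + 1 → x ≠ r ∧ par x = y := by
    intro x y h hd
    have hx : x ≠ r := by
      rintro rfl
      simp at hd
    exact ⟨hx, by rw [hpar x hx]; exact huniq x _ _ (hf1 x hx) h (hf2 x hx) hd⟩
  refine ⟨⟨r, par, G.dist r, if_pos rfl, fun x hx => by rw [hpar x hx]; exact hf2 x hx⟩, rfl, ?_, ?_⟩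
  · intro u v h
    rcases hG.dist_eq_dist_add_one_of_adj r h with h1 | h1
    · exact Or.inl (key u v h h1)
    · exact Or.inr (key v u h.symm h1)
  · rintro v w ⟨h, hd⟩
    exact key w v h.symm hd

namespace ParentTree

theorem gridSeg_comm (a b : ℤ × ℤ) : gridSeg a b = gridSeg b a := segment_symm ..

theorem CanDraw.exists_gridDrawing {V : Type u} [Fintype V] {G : SimpleGraph V} {r : V}
    {T : ParentTree V} (hr : T.root = r)
    (hadj : ∀ u v, G.Adj u v → u ≠ r ∧ T.par u = v ∨ v ≠ r ∧ T.par v = u)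
    (hchild : ∀ v w, IsChildOf G r v w → w ≠ r ∧ T.par w = v) {W H : ℕ} {O : ℤ × ℤ}
    (hd : T.CanDraw Upward r O (box 0 0 W H)) :
    ∃ D : StraightLineGridDrawing G W H, D.IsUpward r := by
  obtain ⟨pos, -, hd⟩ := hd
  have hmem : ∀ x, x ∈ T.sub r := fun x => hr ▸ mem_sub_root x
  -- Turns the drawing upside down and passes from coordinates starting at 0 to coordinates starting
  -- at 1.
  let f : ℤ × ℤ → ℤ × ℤ := fun p => (p.1 + 1, H - p.2)
  have seg : ∀ a b p, p ∈ segment ℝ (gridPoint (f a)) (gridPoint (f b)) →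
      ((p.1 - 1, H - p.2) : ℝ × ℝ) ∈ gridSeg a b := by
    intro a b p hp
    obtain ⟨t, h0, h1, e1, e2⟩ := mem_gridSeg.1 hp
    refine mem_gridSeg.2 ⟨t, h0, h1, ?_, ?_⟩
    · simp only [e1, f]; push_cast; ring
    · simp only [e2, f]; push_cast; ring
  have back : ∀ a (p : ℝ × ℝ), ((p.1 - 1, H - p.2) : ℝ × ℝ) = gridPoint a → p = gridPoint (f a) := by
    intro a p h
    simp only [gridPoint, Prod.mk.injEq] at h
    ext
    · simp only [gridPoint, f]; push_cast; linarith [h.1]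
    · simp only [gridPoint, f]; push_cast; linarith [h.2]
  have edge : ∀ u v, G.Adj u v → ∃ x, x ≠ r ∧ s(u, v) = s(x, T.par x) ∧
      gridSeg (pos u) (pos v) = gridSeg (pos (T.par x)) (pos x) := by
    intro u v h
    rcases hadj u v h with ⟨h1, h2⟩ | ⟨h1, h2⟩
    · exact ⟨u, h1, by rw [h2], by rw [h2, gridSeg_comm]⟩
    · exact ⟨v, h1, by rw [h2, Sym2.eq_swap], by rw [h2]⟩
  have ends : ∀ {u v x w : V}, s(u, v) = s(x, T.par x) → (w = x ∨ w = T.par x) →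
      (w = u ∨ w = v) := by
    intro u v x w h hw
    have : w ∈ s(x, T.par x) := by simpa using hw
    rw [← h] at this
    simpa using this
  have hbox : ∀ x, 0 ≤ (pos x).1 ∧ (pos x).1 + 1 ≤ W ∧ 0 ≤ (pos x).2 ∧ (pos x).2 + 1 ≤ H := by
    intro x
    obtain ⟨h1, h2, h3, h4⟩ := hd.pt_mem x (hmem x)
    simp only [gridPoint] at h1 h2 h3 h4
    push_cast at h1 h2 h3 h4
    refine ⟨by exact_mod_cast h1, ?_, by exact_mod_cast h3, ?_⟩
    · have : ((pos x).1 + 1 : ℝ) ≤ W := by linarith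
      exact_mod_cast this
    · have : ((pos x).2 + 1 : ℝ) ≤ H := by linarith
      exact_mod_cast this
  refine ⟨⟨fun x => f (pos x), ?_, ?_, ?_, ?_, ?_⟩, ?_⟩
  · intro x
    have := hbox x
    exact ⟨by simp only [f]; omega, by simp only [f]; omega⟩
  · intro x
    have := hbox x
    exact ⟨by simp only [f]; omega, by simp only [f]; omega⟩
  · intro x y h
    simp only [f, Prod.mk.injEq] at h
    exact hd.inj (hmem x) (hmem y) (Prod.ext (by omega) (by omega))
  · intro u v w h hw
    obtain ⟨x, hx, hs, e⟩ := edge u v h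
    have h1 := seg _ _ _ hw
    rw [e] at h1
    have h2 : (((gridPoint (f (pos w))).1 - 1, H - (gridPoint (f (pos w))).2) : ℝ × ℝ) =
        gridPoint (pos w) := by
      simp [gridPoint, f]
    rw [h2] at h1
    exact ends hs (hd.avoid (hmem w) (hmem x) hx h1)
  · intro u v x y h h' hne p hp hp'
    obtain ⟨a, ha, hs, e⟩ := edge u v h
    obtain ⟨b, hb, hs', e'⟩ := edge x y h'
    have h1 := seg _ _ _ hp
    have h2 := seg _ _ _ hp'
    rw [e] at h1
    rw [e'] at h2
    obtain ⟨w, hw, hw', hpw⟩ := hd.cross a (hmem a) b (hmem b) ha hb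
      (fun hab => hne (by rw [hs, hs', hab])) _ h1 h2
    exact ⟨w, ends hs hw, ends hs' hw', back _ _ hpw⟩
  · intro v w h
    obtain ⟨h1, h2⟩ := hchild v w h
    have := hd.rel w (hmem w) h1
    rw [h2] at this
    simp only [Upward] at this
    simp only [f]
    omega

/-- Every tree with `n` vertices has a drawing of area `O(n √(log n) log log n)`. -/
theorem exists_drawing_area {V : Type u} [Fintype V] (T : ParentTree V) {n Q l : ℕ}
    (hn : Fintype.card V = n) (hQ : Q = Nat.sqrt (Nat.log 2 n) + 1)
    (hl : l = Nat.log 2 (4 * Q ^ 2) + 16) :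
    ∃ (W H : ℕ) (O : ℤ × ℤ), T.CanDraw Upward T.root O (box 0 0 W H) ∧
      W * H ≤ 3600 * (n * (Q * l)) := by
  have hsz : T.sz T.root = n := by rw [sz, sub_root, card_univ, hn]
  have hQ1 : 1 ≤ Q := by omega
  have hQ2 : 1 ≤ Q ^ 2 := Nat.one_le_pow _ _ hQ1
  have hlog : Nat.log 2 n < Q ^ 2 := by rw [hQ, sq]; exact Nat.lt_succ_sqrt _
  -- For large `n` the width `18 * Q ^ 2` suffices because `log₂ n < Q ^ 2`; otherwise `log₂ n + 1 ≤
  -- l` and the basic drawing is good enough.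
  by_cases h : 4 * Q ^ 2 < n
  · obtain ⟨⟨H, hH, -, hd⟩, -⟩ := exists_drawing (T := T) (l := l) hQ1 hl.ge T.root (by rw [hsz]; exact h)
      (18 * Q ^ 2) (by rw [hsz]; omega)
    refine ⟨18 * Q ^ 2, H, _, hd, ?_⟩
    rw [hsz] at hH
    calc 18 * Q ^ 2 * H = 18 * Q * (Q * H) := by ring
      _ ≤ 18 * Q * (200 * l * n) := Nat.mul_le_mul_left _ (by omega)
      _ = 3600 * (n * (Q * l)) := by ring
  · refine ⟨n, Nat.log 2 n + 1, (0, 0), ?_, ?_⟩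
    · have := (canDraw_log (T := T) T.root).upward
      rw [hsz] at this
      exact_mod_cast this
    · have h1 : Nat.log 2 n ≤ Nat.log 2 (4 * Q ^ 2) := Nat.log_mono_right (by omega)
      have h2 : Nat.log 2 n + 1 ≤ Q * l := by nlinarith
      nlinarith

end ParentTree

/-! ### Asymptotics -/

theorem natLog_two_le (n : ℕ) (hn : 1 ≤ n) : (Nat.log 2 n : ℝ) ≤ 2 * Real.log n := by
  have h1 : (2 : ℝ) ^ Nat.log 2 n ≤ n := by exact_mod_cast Nat.pow_log_le_self 2 (by omega)
  have h2 := Real.log_le_log (by positivity) h1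
  rw [Real.log_pow] at h2
  have h3 := Real.log_two_gt_d9
  have h4 : (0 : ℝ) ≤ Nat.log 2 n := by positivity
  nlinarith

theorem exists_asymptotic_bound : ∃ C : ℝ, 0 < C ∧ ∀ n Q l : ℕ, 3 ≤ n →
    Q = Nat.sqrt (Nat.log 2 n) + 1 → l = Nat.log 2 (4 * Q ^ 2) + 16 →
    (Q * l : ℝ) ≤ C * (Real.sqrt (Real.log n) * Real.log (Real.log n) ^ 2) := by
  have hexp : Real.exp 1 < 3 := by have := Real.exp_one_lt_d9; linarith
  have hlog3 : 1 < Real.log 3 := by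
    rw [Real.lt_log_iff_exp_lt (by norm_num)]; exact hexp
  -- As `log log n ≥ δ > 0`, constants and linear terms are absorbed into the square of `log log n`;
  -- a single factor would do.
  set δ := Real.log (Real.log 3) with hδ
  have hδ0 : 0 < δ := Real.log_pos hlog3
  refine ⟨3 * (2 / δ + 86 / δ ^ 2), by positivity, ?_⟩
  intro n Q l hn hQ hl
  have hnR : (3 : ℝ) ≤ n := by exact_mod_cast hn
  set x := Real.log n with hx
  have hx3 : Real.log 3 ≤ x := Real.log_le_log (by norm_num) hnR
  have hx1 : 1 ≤ x := by linarith
  set u := Real.log x with hu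
  have hδu : δ ≤ u := Real.log_le_log (by linarith) hx3
  have hs1 : 1 ≤ Real.sqrt x := Real.one_le_sqrt.2 hx1
  have hQ3 : (Q : ℝ) ≤ 3 * Real.sqrt x := by
    have h1 : (Nat.sqrt (Nat.log 2 n) : ℝ) ≤ Real.sqrt (Nat.log 2 n) := Real.nat_sqrt_le_real_sqrt
    have h2 : Real.sqrt (Nat.log 2 n) ≤ Real.sqrt (2 ^ 2 * x) := by
      apply Real.sqrt_le_sqrt
      have := natLog_two_le n (by omega)
      linarith
    rw [Real.sqrt_mul (by norm_num), Real.sqrt_sq (by norm_num)] at h2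
    rw [hQ]; push_cast
    linarith
  have hQ1 : (1 : ℝ) ≤ Q := by rw [hQ]; push_cast; linarith [Nat.cast_nonneg (α := ℝ) (Nat.sqrt (Nat.log 2 n))]
  have hl' : (l : ℝ) ≤ 2 * u + 86 := by
    have h1 := natLog_two_le (4 * Q ^ 2) (Nat.mul_pos (by norm_num) (pow_pos (by omega) 2))
    have h2 : Real.log ((4 * Q ^ 2 : ℕ) : ℝ) ≤ Real.log (36 * x) := by
      apply Real.log_le_log
      · push_cast; positivity
      · push_cast
        have := pow_le_pow_left₀ (by linarith) hQ3 2
        rw [mul_pow, Real.sq_sqrt (by linarith)] at this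
        linarith
    rw [Real.log_mul (by norm_num) (by linarith)] at h2
    have h3 := Real.log_le_sub_one_of_pos (show (0 : ℝ) < 36 by norm_num)
    rw [hl]; push_cast at *
    linarith
  have hu2 : 2 * u + 86 ≤ (2 / δ + 86 / δ ^ 2) * u ^ 2 := by
    have h1 : 2 * u ≤ 2 / δ * u ^ 2 := by
      rw [div_mul_eq_mul_div, le_div_iff₀ hδ0]
      nlinarith
    have h2 : 86 ≤ 86 / δ ^ 2 * u ^ 2 := by
      rw [div_mul_eq_mul_div, le_div_iff₀ (by positivity)]
      nlinarith
    linarith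
  calc (Q * l : ℝ) ≤ 3 * Real.sqrt x * ((2 / δ + 86 / δ ^ 2) * u ^ 2) := by
        apply mul_le_mul hQ3 (hl'.trans hu2) (by positivity) (by positivity)
    _ = 3 * (2 / δ + 86 / δ ^ 2) * (Real.sqrt x * u ^ 2) := by ring

theorem mainTheorem3 :
    ∃ C : ℝ, 0 < C ∧ ∀ n : ℕ, 3 ≤ n →
      ∀ (V : Type u) [Fintype V] (G : SimpleGraph V) (r : V),
        G.IsTree → Fintype.card V = n →
          ∃ (W H : ℕ) (D : StraightLineGridDrawing G W H), D.IsUpward r ∧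
            ((W * H : ℕ) : ℝ) ≤
              C * ((n : ℝ) * Real.sqrt (Real.log n) * (Real.log (Real.log n)) ^ 2) := by
  obtain ⟨C, hC, hbound⟩ := exists_asymptotic_bound
  refine ⟨3600 * C, by positivity, ?_⟩
  intro n hn V _ G r hG hcard
  obtain ⟨T, rfl, hadj, hchild⟩ := exists_parentTree hG r
  obtain ⟨W, H, O, hd, harea⟩ := T.exists_drawing_area hcard rfl rfl
  obtain ⟨D, hD⟩ := hd.exists_gridDrawing rfl hadj hchild
  refine ⟨W, H, D, hD, ?_⟩
  have h1 := hbound n _ _ hn rfl rfl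
  have h2 : ((W * H : ℕ) : ℝ) ≤ ((3600 * (n * ((Nat.sqrt (Nat.log 2 n) + 1) *
      (Nat.log 2 (4 * (Nat.sqrt (Nat.log 2 n) + 1) ^ 2) + 16))) : ℕ) : ℝ) := by exact_mod_cast harea
  have h3 := mul_le_mul_of_nonneg_left h1 (Nat.cast_nonneg (α := ℝ) n)
  rw [Nat.cast_mul 3600, Nat.cast_mul n, Nat.cast_mul (Nat.sqrt _ + 1)] at h2
  push_cast at h2 h3 ⊢
  linarith
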